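/- **Model.** Fix $T>0$, finitely many types $k=1,\dots,K$ with matrices $A_k,F_k,H_k\in\mathbb R^{n\times n}$, $B_k,S_k\in\mathbb R^{n\times m}$, $\sigma_k,\sigma_0\in\mathbb R^{n\times r}$, symmetric $\hat Q_k,Q_k\in\mathbb R^{n\times n}$, $R_k\in\mathbb R^{m\times m}$, vectors $\eta_k\in\mathbb R^n$, integrable functions $b_k:[0,T]\to\mathbb R^n$, constants $\gamma_k>0$ and proportions $\pi=(\pi_1,\dots,\pi_K)$; put $F_k^\pi=[\pi_1F_k\ \cdots\ \pi_KF_k]$ and $H_k^\pi=[\pi_1H_k\ \cdots\ \pi_KH_k]$. On a probability space there are independent continuous $\mathbb R^r$-valued Brownian motions $w^0,w^1,w^2,\dots$ and i.i.d. initial states $x_0^1,x_0^2,\dots$, independent of the Brownian motions. Each type consists of infinitely many agents, and $\pi_l$ is the limiting proportion of the agents of type $l$. Let $\mathcal F^0_t=\sigma(w^0_s:s\le t)$ and $\mathcal F^i_t=\sigma(x^i_0,\,w^0_s,\,w^i_s:s\le t)$. The set $\mathcal U^i$ of admissible controls of agent $i$ consists of the $\mathcal F^i$-adapted $\mathbb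 R^m$-valued processes on $[0,T]$ with continuous paths and $\mathbb E\int_0^T u_t^\top u_t\,dt<\infty$. Every agent $j$ uses some $u^j\in\mathcal U^j$, and its state, with $k$ the type of $j$, solves $$dx^j_t=\big(A_kx^j_t+F_k^\pi\bar x_t+B_ku^j_t+b_k(t)\big)dt+\sigma_k\,dw^j_t+\sigma_0\,dw^0_t ,\qquad x^j(0)=x^j_0,$$ where the mean field $\bar x=(\bar x^1,\dots,\bar x^K)$ is a continuous $\mathcal F^0$-adapted process such that, for every $t$ and $l$, $\bar x^l_t$ is almost surely the limit of the empirical averages of the states at time $t$ of the agents of type $l$. Fix an agent $i$ of type $k$. For a state process $x$, a mean field $\bar x$ and a control $u$, let $e_t=x_t-H_k^\pi\bar x_t-\eta_k$ and $$G_T=\frac1{\gamma_k}\Big[\tfrac12e_T^\top\hat Q_ke_T+\int_0^T\tfrac12\big(e_t^\top Q_ke_t+2e_t^\top S_ku_t+u_t^\top R_ku_t\big)dt\Big],\qquad J^{i,\infty}(u)=\gamma_k\log\mathbb E[\exp G_T].$$ In $J^{i,\infty}(v)$, agent $i$ alone replaces its control $u^i$ by $v$: the state processes of the other agents are kept, $x^i$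 is replaced by the state under $v$, and $\bar x$ by the limit of the averages so modified. **Theorem.** Suppose that $\hat Q_k\ge0$, $R_k>0$ and $Q_k-S_kR_k^{-1}S_k^\top\ge0$. Let $\omega\in\mathcal U^i$, and suppose that for some $\varepsilon_0>0$ the expectation defining $J^{i,\infty}(u^i+\varepsilon\omega)$ is finite whenever $|\varepsilon|<\varepsilon_0$. Let $e$ and $G_T^i(u)$ be formed with $x^i,\bar x,u^i$, and suppose that $$\mathbb E\Big[\exp(G^i_T(u))\Big(|e_T|^2+\int_0^T(|e_t|^2+|u^i_t|^2)\,dt\Big)\Big]<\infty .$$ Then the random vector $$Y=\exp(G^i_T(u))\Big(e^{A_k^\top T}\hat Q_ke_T+\int_0^Te^{A_k^\top s}(Q_ke_s+S_ku^i_s)\,ds\Big)$$ is integrable, and the processes $M^i_{1,t}=\mathbb E[\exp(G^i_T(u))\mid\mathcal F^i_t]$ and $M^i_{2,t}=\mathbb E[Y\mid\mathcal F^i_t]$ have jointly measurable versions on $[0,T]$. For all such versions, with $$h^k_t=M^i_{1,t}\Big(S_k^\top e_t+R_ku^i_t-B_k^\top\int_0^te^{A_k^\top(s-t)}(Q_ke_s+S_ku^i_s)\,ds\Big)+B_k^\top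 e^{-A_k^\top t}M^i_{2,t},$$ the function $\omega_t^\top h^k_t$ is integrable on $\Omega\times[0,T]$, and $J^{i,\infty}$ is Gâteaux differentiable at $u^i$ in the direction $\omega$, with $$\lim_{\varepsilon\to0}\frac{J^{i,\infty}(u^i+\varepsilon\omega)-J^{i,\infty}(u^i)}{\varepsilon}=\frac{\mathbb E\big[\int_0^T\omega_t^\top h^k_t\,dt\big]}{\mathbb E[\exp(G_T^i(u))]} .$$ -/

import Mathlib

open MeasureTheory ProbabilityTheory Filter Set
open scoped Topology Matrix NNReal ENNReal

noncomputable section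

namespace RiskMFG

/-- Deterministic data of the linear-quadratic-Gaussian model with `K` types, state space `ℝⁿ`,
control space `ℝᵐ` and `ℝʳ`-valued Brownian motions on the horizon `[0, T]`. -/
structure Model (K n m r : ℕ) where
  T : ℝ
  T_pos : 0 < T
  A : Fin K → Matrix (Fin n) (Fin n) ℝ
  F : Fin K → Matrix (Fin n) (Fin n) ℝ
  B : Fin K → Matrix (Fin n) (Fin m) ℝ
  b : Fin K → ℝ → Fin n → ℝ
  b_integrable : ∀ k, IntervalIntegrable (b k) volume 0 T
  σ : Fin K → Matrix (Fin n) (Fin r) ℝ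
  σ₀ : Matrix (Fin n) (Fin r) ℝ
  H : Fin K → Matrix (Fin n) (Fin n) ℝ
  η : Fin K → Fin n → ℝ
  Qhat : Fin K → Matrix (Fin n) (Fin n) ℝ
  Qhat_symm : ∀ k, (Qhat k).IsSymm
  Q : Fin K → Matrix (Fin n) (Fin n) ℝ
  Q_symm : ∀ k, (Q k).IsSymm
  S : Fin K → Matrix (Fin n) (Fin m) ℝ
  R : Fin K → Matrix (Fin m) (Fin m) ℝ
  R_symm : ∀ k, (R k).IsSymm
  γ : Fin K → ℝ
  γ_pos : ∀ k, 0 < γ k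
  /-- limiting proportions of the types -/
  π : Fin K → ℝ

namespace Model

variable {K n m r : ℕ} (D : Model K n m r) (k : Fin K)

/-- `π ⊗ M = [π₁ M ⋯ π_K M]`, an `n × Kn` matrix; its columns are indexed by
(block, column in the block). -/
def blockRow (M : Matrix (Fin n) (Fin n) ℝ) : Matrix (Fin n) (Fin K × Fin n) ℝ :=
  Matrix.of fun a p => D.π p.1 * M a p.2

/-- The tracking error `x - H_k^π x̄ - η_k`. -/
def err (x : Fin n → ℝ) (xb : Fin K × Fin n → ℝ) : Fin n → ℝ :=
  x - D.blockRow (D.H k) *ᵥ xb - D.η k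

/-- Terminal cost `g^k`. -/
def g (x : Fin n → ℝ) (xb : Fin K × Fin n → ℝ) : ℝ :=
  (1 / 2) * (D.err k x xb ⬝ᵥ D.Qhat k *ᵥ D.err k x xb)

/-- Running cost `f^k`. -/
def f (x : Fin n → ℝ) (xb : Fin K × Fin n → ℝ) (u : Fin m → ℝ) : ℝ :=
  (1 / 2) * (D.err k x xb ⬝ᵥ D.Q k *ᵥ D.err k x xb
    + 2 * (D.err k x xb ⬝ᵥ D.S k *ᵥ u) + u ⬝ᵥ D.R k *ᵥ u)

/-- Drift of the state of an agent of type `k`. -/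
def drift (t : ℝ) (x : Fin n → ℝ) (xb : Fin K × Fin n → ℝ) (u : Fin m → ℝ) : Fin n → ℝ :=
  D.A k *ᵥ x + D.blockRow (D.F k) *ᵥ xb + D.B k *ᵥ u + D.b k t

/-- `Q̂_k ≥ 0`, `R_k > 0` and `Q_k - S_k R_k⁻¹ S_kᵀ ≥ 0`. -/
def ConvexityCondition : Prop :=
  (D.Qhat k).PosSemidef ∧ (D.R k).PosDef ∧
    (D.Q k - D.S k * (D.R k)⁻¹ * (D.S k)ᵀ).PosSemidef

variable {Ω : Type*}

/-- The exponent `G_T`, for a state process `x`, a mean field `xb` and a control `u`. -/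
def G (x : ℝ → Ω → Fin n → ℝ) (xb : ℝ → Ω → Fin K × Fin n → ℝ) (u : ℝ → Ω → Fin m → ℝ)
    (ω : Ω) : ℝ :=
  (1 / D.γ k) * (D.g k (x D.T ω) (xb D.T ω)
    + ∫ t in (0 : ℝ)..D.T, D.f k (x t ω) (xb t ω) (u t ω))

/-- `Q_k (x_s - H_k^π x̄_s - η_k) + S_k u_s`. -/
def adjointSource (x : ℝ → Ω → Fin n → ℝ) (xb : ℝ → Ω → Fin K × Fin n → ℝ)
    (u : ℝ → Ω → Fin m → ℝ) (s : ℝ) (ω : Ω) : Fin n → ℝ :=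
  D.Q k *ᵥ D.err k (x s ω) (xb s ω) + D.S k *ᵥ u s ω

/-- The random vector whose conditional expectations are `M₂`:
`exp(G_T) (e^{Aᵀ T} Q̂ (x_T - H^π x̄_T - η) + ∫₀ᵀ e^{Aᵀ s} (Q (x_s - H^π x̄_s - η) + S u_s) ds)`. -/
def weightedAdjoint (x : ℝ → Ω → Fin n → ℝ) (xb : ℝ → Ω → Fin K × Fin n → ℝ)
    (u : ℝ → Ω → Fin m → ℝ) (ω : Ω) : Fin n → ℝ :=
  Real.exp (D.G k x xb u ω) •
    (NormedSpace.exp (D.T • (D.A k)ᵀ) *ᵥ (D.Qhat k *ᵥ D.err k (x D.T ω) (xb D.T ω))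
      + ∫ s in (0 : ℝ)..D.T, NormedSpace.exp (s • (D.A k)ᵀ) *ᵥ D.adjointSource k x xb u s ω)

/-- The process `h^k`, given the processes `M₁` and `M₂`. -/
def h (x : ℝ → Ω → Fin n → ℝ) (xb : ℝ → Ω → Fin K × Fin n → ℝ) (u : ℝ → Ω → Fin m → ℝ)
    (M₁ : ℝ → Ω → ℝ) (M₂ : ℝ → Ω → Fin n → ℝ) (t : ℝ) (ω : Ω) : Fin m → ℝ :=
  M₁ t ω • ((D.S k)ᵀ *ᵥ D.err k (x t ω) (xb t ω) + D.R k *ᵥ u t ω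
      - (D.B k)ᵀ *ᵥ ∫ s in (0 : ℝ)..t,
          NormedSpace.exp ((s - t) • (D.A k)ᵀ) *ᵥ D.adjointSource k x xb u s ω)
    + (D.B k)ᵀ *ᵥ (NormedSpace.exp (-t • (D.A k)ᵀ) *ᵥ M₂ t ω)

end Model

/-- The agents `0, 1, 2, …` of the infinite population: their types, their initial states and the
driving Brownian motions. `w none` is the common noise `w⁰` and `w (some j)` is the idiosyncratic
noise of agent `j`. -/
structure Agents {K n m r : ℕ} (D : Model K n m r) {Ω : Type*} [MeasurableSpace Ω]
    (P : Measure Ω) where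
  type : ℕ → Fin K
  type_infinite : ∀ l, {j | type j = l}.Infinite
  type_proportion : ∀ l, Tendsto
    (fun N : ℕ => (((Finset.range N).filter fun j => type j = l).card : ℝ) / N) atTop (𝓝 (D.π l))
  w : Option ℕ → ℝ≥0 → Ω → Fin r → ℝ
  w_measurable : ∀ j t, Measurable (w j t)
  w_continuous : ∀ j ω, Continuous fun t => w j t ω
  w_brownian : ∀ j c, IsBrownianReal (fun t ω => w j t ω c) P
  w_indep : iIndepFun (fun (p : Option ℕ × Fin r) (ω : Ω) (t : ℝ≥0) => w p.1 t ω p.2) P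
  x₀ : ℕ → Ω → Fin n → ℝ
  x₀_measurable : ∀ j, Measurable (x₀ j)
  x₀_identDistrib : ∀ i j, IdentDistrib (x₀ i) (x₀ j) P P
  x₀_iIndep : iIndepFun x₀ P
  x₀_indep_w : IndepFun (fun (ω : Ω) (j : ℕ) => x₀ j ω)
    (fun (ω : Ω) (j : Option ℕ) (t : ℝ≥0) => w j t ω) P

namespace Agents

variable {K n m r : ℕ} {D : Model K n m r} {Ω : Type*} [MeasurableSpace Ω] {P : Measure Ω}
  (a : Agents D P)

/-- The σ-algebra generated by the Brownian motion with index `j` up to time `t`. -/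
abbrev noiseSigma (j : Option ℕ) (t : ℝ) : MeasurableSpace Ω :=
  ⨆ s ∈ {s : ℝ≥0 | (s : ℝ) ≤ t}, MeasurableSpace.comap (a.w j s) inferInstance

/-- The common-noise filtration `ℱ⁰`. -/
abbrev commonFiltration (t : ℝ) : MeasurableSpace Ω := a.noiseSigma none t

/-- The filtration `ℱⁱ` of agent `i`, generated by its initial state, the common noise and its
idiosyncratic noise. -/
abbrev filtration (i : ℕ) (t : ℝ) : MeasurableSpace Ω :=
  MeasurableSpace.comap (a.x₀ i) inferInstance ⊔ a.noiseSigma none t ⊔ a.noiseSigma (some i) t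

/-- Admissible controls of agent `i`: `ℱⁱ`-adapted `ℝᵐ`-valued processes on `[0, T]` with
continuous paths and `E ∫₀ᵀ uᵀ u dt < ∞`. -/
structure IsAdmissible (i : ℕ) (u : ℝ → Ω → Fin m → ℝ) : Prop where
  adapted : ∀ t ∈ Icc 0 D.T, Measurable[a.filtration i t] (u t)
  continuous : ∀ ω, ContinuousOn (fun t => u t ω) (Icc 0 D.T)
  sq_integrable :
    ∫⁻ ω, ∫⁻ t in Icc 0 D.T, ENNReal.ofReal (u t ω ⬝ᵥ u t ω) ∂volume ∂P < ∞

/-- `x` is the state process of agent `i` under the mean field `xb` and the control `u`: a strong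
solution on `[0, T]` of
`dx = (A_k x + F_k^π x̄ + B_k u + b_k) dt + σ_k dwⁱ + σ₀ dw⁰`, `x(0) = x₀ⁱ`, `k` the type of `i`.
The noise is additive, so the stochastic integrals are the products `σ_k wⁱ_t` and `σ₀ w⁰_t`. -/
structure IsState (i : ℕ) (xb : ℝ → Ω → Fin K × Fin n → ℝ) (u : ℝ → Ω → Fin m → ℝ)
    (x : ℝ → Ω → Fin n → ℝ) : Prop where
  adapted : ∀ t ∈ Icc 0 D.T, Measurable[a.filtration i t] (x t)
  continuous : ∀ ω, ContinuousOn (fun t => x t ω) (Icc 0 D.T)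
  equation : ∀ᵐ ω ∂P, ∀ t ∈ Icc 0 D.T,
    x t ω = a.x₀ i ω
      + (∫ s in (0 : ℝ)..t, D.drift (a.type i) s (x s ω) (xb s ω) (u s ω))
      + D.σ (a.type i) *ᵥ a.w (some i) t.toNNReal ω + D.σ₀ *ᵥ a.w none t.toNNReal ω

/-- Empirical average of the states of the agents of type `l` among the first `N` agents. -/
def empiricalMean (x : ℕ → ℝ → Ω → Fin n → ℝ) (l : Fin K) (N : ℕ) (t : ℝ) (ω : Ω) : Fin n → ℝ :=
  (((Finset.range N).filter fun j => a.type j = l).card : ℝ)⁻¹ •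
    ∑ j ∈ (Finset.range N).filter (fun j => a.type j = l), x j t ω

/-- `xb` is the mean field of the population with states `x`: a continuous process adapted to the
common-noise filtration whose block `l` is the limit of the empirical averages over the agents of
type `l`. -/
structure IsMeanField (x : ℕ → ℝ → Ω → Fin n → ℝ) (xb : ℝ → Ω → Fin K × Fin n → ℝ) : Prop where
  adapted : ∀ t ∈ Icc 0 D.T, Measurable[a.commonFiltration t] (xb t)
  continuous : ∀ ω, ContinuousOn (fun t => xb t ω) (Icc 0 D.T)
  limit : ∀ t ∈ Icc 0 D.T, ∀ l, ∀ᵐ ω ∂P,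
    Tendsto (fun N => a.empiricalMean x l N t ω) atTop (𝓝 fun c => xb t ω (l, c))

end Agents

/-- The infinite population: every agent `j` uses an admissible control `u j`, its state is `x j`,
and `xbar` is the mean field. -/
structure Population {K n m r : ℕ} (D : Model K n m r) {Ω : Type*} [MeasurableSpace Ω]
    (P : Measure Ω) extends Agents D P where
  u : ℕ → ℝ → Ω → Fin m → ℝ
  u_admissible : ∀ j, toAgents.IsAdmissible j (u j)
  x : ℕ → ℝ → Ω → Fin n → ℝ
  xbar : ℝ → Ω → Fin K × Fin n → ℝ
  x_state : ∀ j, toAgents.IsState j xbar (u j) (x j)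
  xbar_meanField : toAgents.IsMeanField x xbar

namespace Population

variable {K n m r : ℕ} {D : Model K n m r} {Ω : Type*} [MeasurableSpace Ω] {P : Measure Ω}
  (p : Population D P)

/-- Agent `i` alone replaces its control by `v`: `y` is its new state and `yb` the new mean field,
that is, the limit of the empirical averages in which `x i` is replaced by `y`. -/
structure IsDeviation (i : ℕ) (v : ℝ → Ω → Fin m → ℝ) (y : ℝ → Ω → Fin n → ℝ)
    (yb : ℝ → Ω → Fin K × Fin n → ℝ) : Prop where
  state : p.IsState i yb v y
  meanField : p.IsMeanField (Function.update p.x i y) yb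

/-- The expectation in the cost of agent `i` under the control `v` is finite. -/
def HasFiniteCost (i : ℕ) (v : ℝ → Ω → Fin m → ℝ) : Prop :=
  ∃ y yb, p.IsDeviation i v y yb ∧
    Integrable (fun ω => Real.exp (D.G (p.type i) y yb v ω)) P

open Classical in
/-- The cost functional `J^{i,∞}(v) = γ_k log E[exp G_T]` of agent `i`, the controls of all other
agents being fixed. State and mean field under `v` are unique up to indistinguishability, so that
the choice of a version does not matter. -/
def J (i : ℕ) (v : ℝ → Ω → Fin m → ℝ) : ℝ :=
  if h : ∃ q : (ℝ → Ω → Fin n → ℝ) × (ℝ → Ω → Fin K × Fin n → ℝ), p.IsDeviation i v q.1 q.2 then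
    D.γ (p.type i) *
      Real.log (∫ ω, Real.exp (D.G (p.type i) h.choose.1 h.choose.2 v ω) ∂P)
  else 0

end Population

/-- `d` is the Gâteaux derivative of `J` at `u` in the direction `v`. -/
def HasGateauxDerivative {E : Type*} [AddCommGroup E] [Module ℝ E] (J : E → ℝ) (u v : E)
    (d : ℝ) : Prop :=
  Tendsto (fun ε : ℝ => (J (u + ε • v) - J u) / ε) (𝓝[≠] 0) (𝓝 d)

/-- `M` is a jointly measurable version on `[0, T]` of the process `t ↦ E[X | ℱ_t]`. -/
structure IsCondExpProcess {Ω : Type*} [MeasurableSpace Ω] (P : Measure Ω)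
    {E : Type*} [NormedAddCommGroup E] [NormedSpace ℝ E] [CompleteSpace E] [MeasurableSpace E]
    (ℱ : ℝ → MeasurableSpace Ω) (T : ℝ) (X : Ω → E) (M : ℝ → Ω → E) : Prop where
  measurable : Measurable (Function.uncurry M)
  eq_condExp : ∀ t ∈ Icc 0 T, M t =ᵐ[P] P[X | ℱ t]

end RiskMFG

end

/-!
The deviation of one agent is negligible for the mean field: each type has infinitely many agents,
so the limits of the empirical averages do not move (`Agents.IsMeanField.ae_eq_of_update`). The
state equation has additive noise and a linear drift, so under the control `u + ε v` the state is
`x + ε z`, where `z` is given pathwise by variation of constants (`Population.IsDeviation.ae_eq`).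
The cost is a quadratic functional of the error and the control, and the exponent is therefore
almost surely a quadratic polynomial `G + ε a + ε² b` (`Population.IsDeviation.G_ae_eq`).

By the convexity condition `b` is nonnegative; even more, completing the square shows that it
dominates a multiple of `∫₀ᵀ |v|²` (`exists_pos_mul_integral_sq_norm_le_quadCost`). Hence
`ε ↦ exp (G + ε a + ε² b)` is convex, its difference quotients at `0` are bounded by the integrable
endpoint values, and one may differentiate under the expectation
(`hasDerivAt_integral_exp_quadratic`). The same integrability at `±ε` gives
`E[exp G ∫₀ᵀ |v|²] < ∞` (`integrable_exp_mul_quadratic`), so that, under the measure weighted by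
`exp G`, the error, the control and the direction are all square integrable.

It remains to identify `E[exp G · a]`. Pathwise, an integration by parts moves the response `z` to
the control `v` (`quadCostDeriv_eq_integral`); the result pairs adapted processes with `exp G` and
with the random vector `Y`. Square integrability makes these pairings integrable on `Ω × [0, T]`
(`integrable_prod_adjoint`), and Fubini together with the pull-out property of conditional
expectations replaces `exp G` and `Y` by `M₁` and `M₂` (`integrable_prod_condExpProcess`).

Jointly measurable versions of `M₁` and `M₂` exist because the filtration is left-continuous, being
generated by continuous paths (`Agents.filtration_le_iSup`, `exists_isCondExpProcess_real`).
-/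

namespace RiskMFG

/-! ### Matrix-vector calculus along paths -/

section Calculus

variable {ι κ : Type*} [Fintype κ]

theorem continuousOn_dotProduct {α : Type*} [TopologicalSpace α] {x y : α → κ → ℝ} {s : Set α}
    (hx : ContinuousOn x s) (hy : ContinuousOn y s) :
    ContinuousOn (fun t => x t ⬝ᵥ y t) s :=
  continuousOn_finsetSum _ fun j _ =>
    ((continuousOn_pi.1 hx) j).mul ((continuousOn_pi.1 hy) j)

theorem continuousOn_mulVec {α : Type*} [TopologicalSpace α] {M : α → Matrix ι κ ℝ}
    {x : α → κ → ℝ} {s : Set α} (hM : ContinuousOn M s) (hx : ContinuousOn x s) :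
    ContinuousOn (fun t => M t *ᵥ x t) s :=
  continuousOn_pi.2 fun j => continuousOn_dotProduct (continuousOn_pi.1 hM j) hx

theorem hasDerivAt_dotProduct {x y : ℝ → κ → ℝ} {x' y' : κ → ℝ} {t : ℝ}
    (hx : HasDerivAt x x' t) (hy : HasDerivAt y y' t) :
    HasDerivAt (fun s => x s ⬝ᵥ y s) (x' ⬝ᵥ y t + x t ⬝ᵥ y') t := by
  have := HasDerivAt.fun_sum (u := Finset.univ) fun j _ =>
    (hasDerivAt_pi.1 hx j).mul (hasDerivAt_pi.1 hy j)
  convert! this using 1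
  simp [dotProduct, Finset.sum_add_distrib]

theorem hasDerivAt_mulVec {M : ℝ → Matrix ι κ ℝ} {M' : Matrix ι κ ℝ} {x : ℝ → κ → ℝ}
    {x' : κ → ℝ} {t : ℝ} (hM : ∀ i j, HasDerivAt (fun s => M s i j) (M' i j) t)
    (hx : HasDerivAt x x' t) :
    HasDerivAt (fun s => M s *ᵥ x s) (M' *ᵥ x t + M t *ᵥ x') t :=
  hasDerivAt_pi.2 fun i => hasDerivAt_dotProduct (hasDerivAt_pi.2 (hM i)) hx

theorem abs_dotProduct_le (x y : κ → ℝ) : |x ⬝ᵥ y| ≤ Fintype.card κ * (‖x‖ * ‖y‖) := by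
  refine (Finset.abs_sum_le_sum_abs _ _).trans ?_
  refine (Finset.sum_le_card_nsmul _ _ (‖x‖ * ‖y‖) fun j _ => ?_).trans_eq (by simp)
  rw [abs_mul]
  exact mul_le_mul (norm_le_pi_norm x j) (norm_le_pi_norm y j) (abs_nonneg _) (norm_nonneg _)

/-- The norm on `κ → ℝ` is the sup norm, so this is an inequality only. -/
theorem sq_norm_le_dotProduct (x : κ → ℝ) : ‖x‖ ^ 2 ≤ x ⬝ᵥ x := by
  have h0 : 0 ≤ x ⬝ᵥ x := Finset.sum_nonneg fun j _ => mul_self_nonneg _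
  rw [← Real.le_sqrt (norm_nonneg _) h0, pi_norm_le_iff_of_nonneg (Real.sqrt_nonneg _)]
  intro j
  apply Real.le_sqrt_of_sq_le
  rw [Real.norm_eq_abs, sq_abs, pow_two]
  exact Finset.single_le_sum (f := fun j => x j * x j) (fun j _ => mul_self_nonneg _)
    (Finset.mem_univ j)

theorem dotProduct_self_nonneg (x : κ → ℝ) : 0 ≤ x ⬝ᵥ x :=
  (sq_nonneg _).trans (sq_norm_le_dotProduct x)

theorem abs_dotProduct_le_sq_add_sq (x y : κ → ℝ) :
    |x ⬝ᵥ y| ≤ Fintype.card κ * (‖x‖ ^ 2 + ‖y‖ ^ 2) :=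
  (abs_dotProduct_le x y).trans (mul_le_mul_of_nonneg_left
    (by nlinarith [sq_nonneg (‖x‖ - ‖y‖), sq_nonneg ‖x‖, sq_nonneg ‖y‖]) (Nat.cast_nonneg _))

variable [Fintype ι]

theorem exists_norm_mulVec_le (M : Matrix ι κ ℝ) : ∃ C, 0 ≤ C ∧ ∀ x, ‖M *ᵥ x‖ ≤ C * ‖x‖ := by
  let L := LinearMap.toContinuousLinearMap (Matrix.mulVecLin M)
  exact ⟨‖L‖, norm_nonneg _, fun x => L.le_opNorm x⟩

variable [DecidableEq ι]

section

attribute [local instance] Matrix.linftyOpNormedRing Matrix.linftyOpNormedAlgebra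

theorem continuous_exp_smul (A : Matrix ι ι ℝ) :
    Continuous fun t : ℝ => NormedSpace.exp (t • A) := by
  have := fun t : ℝ => (hasDerivAt_exp_smul_const (𝕂 := ℝ) A t).continuousAt
  exact continuous_iff_continuousAt.2 this

theorem hasDerivAt_exp_smul_apply (A : Matrix ι ι ℝ) (t : ℝ) (i j : ι) :
    HasDerivAt (fun s : ℝ => NormedSpace.exp (s • A) i j)
      ((NormedSpace.exp (t • A) * A) i j) t := by
  have h := hasDerivAt_exp_smul_const (𝕂 := ℝ) A t
  let L := LinearMap.toContinuousLinearMap (Matrix.entryLinearMap ℝ ℝ i j)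
  exact L.hasFDerivAt.comp_hasDerivAt t h

theorem hasDerivAt_exp_smul_apply' (A : Matrix ι ι ℝ) (t : ℝ) (i j : ι) :
    HasDerivAt (fun s : ℝ => NormedSpace.exp (s • A) i j)
      ((A * NormedSpace.exp (t • A)) i j) t := by
  have h := hasDerivAt_exp_smul_const' (𝕂 := ℝ) A t
  let L := LinearMap.toContinuousLinearMap (Matrix.entryLinearMap ℝ ℝ i j)
  exact L.hasFDerivAt.comp_hasDerivAt t h

theorem exists_norm_exp_smul_mulVec_le (A : Matrix ι ι ℝ) (T : ℝ) :
    ∃ C, 0 ≤ C ∧ ∀ t ∈ Icc (-T) T, ∀ x, ‖NormedSpace.exp (t • A) *ᵥ x‖ ≤ C * ‖x‖ := by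
  obtain ⟨C, hC⟩ := (isCompact_Icc (a := -T) (b := T)).exists_bound_of_continuousOn
    (continuous_exp_smul A).continuousOn
  refine ⟨max C 0, le_max_right _ _, fun t ht x => ?_⟩
  exact (Matrix.linfty_opNorm_mulVec _ _).trans
    (mul_le_mul_of_nonneg_right ((hC t ht).trans (le_max_left _ _)) (norm_nonneg _))

end

theorem exp_add_smul_mulVec (A : Matrix ι ι ℝ) (s t : ℝ) (x : ι → ℝ) :
    NormedSpace.exp ((s + t) • A) *ᵥ x
      = NormedSpace.exp (s • A) *ᵥ (NormedSpace.exp (t • A) *ᵥ x) := by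
  rw [add_smul, Matrix.exp_add_of_commute _ _ (((Commute.refl A).smul_left s).smul_right t),
    Matrix.mulVec_mulVec]

theorem exp_smul_mulVec_exp_neg_smul_mulVec (A : Matrix ι ι ℝ) (t : ℝ) (x : ι → ℝ) :
    NormedSpace.exp (t • A) *ᵥ (NormedSpace.exp (-t • A) *ᵥ x) = x := by
  rw [← exp_add_smul_mulVec]
  simp

theorem dotProduct_exp_smul_mulVec (A : Matrix ι ι ℝ) (t : ℝ) (x y : ι → ℝ) :
    x ⬝ᵥ NormedSpace.exp (t • A) *ᵥ y = (NormedSpace.exp (t • Aᵀ) *ᵥ x) ⬝ᵥ y := by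
  rw [← Matrix.transpose_smul, Matrix.exp_transpose, Matrix.dotProduct_mulVec,
    Matrix.mulVec_transpose]

end Calculus

section Primitive

variable {E : Type*} [NormedAddCommGroup E] {T : ℝ}

theorem intervalIntegrable_of_continuousOn_Icc {f : ℝ → E}
    (hf : ContinuousOn f (Icc 0 T)) {t : ℝ} (ht : t ∈ Icc 0 T) :
    IntervalIntegrable f volume 0 t :=
  (hf.mono (by rw [uIcc_of_le ht.1]; exact Icc_subset_Icc_right ht.2)).intervalIntegrable

variable [NormedSpace ℝ E]

theorem continuousOn_primitive {f : ℝ → E} (hT : 0 ≤ T) (hf : ContinuousOn f (Icc 0 T)) :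
    ContinuousOn (fun t => ∫ s in (0 : ℝ)..t, f s) (Icc 0 T) := by
  have := intervalIntegral.continuousOn_primitive_interval (μ := volume) (f := f) (a := 0) (b := T)
    (by rw [uIcc_of_le hT]; exact hf.integrableOn_Icc)
  rwa [uIcc_of_le hT] at this

theorem hasDerivAt_primitive [CompleteSpace E] {f : ℝ → E} (hf : ContinuousOn f (Icc 0 T)) {t : ℝ}
    (ht : t ∈ Ioo 0 T) : HasDerivAt (fun u => ∫ s in (0 : ℝ)..u, f s) (f t) t :=
  intervalIntegral.integral_hasDerivAt_right
    (intervalIntegrable_of_continuousOn_Icc hf ⟨ht.1.le, ht.2.le⟩)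
    ((hf.mono Ioo_subset_Icc_self).stronglyMeasurableAtFilter isOpen_Ioo t ht)
    (hf.continuousAt (Icc_mem_nhds ht.1 ht.2))

/-- Cauchy-Schwarz against the constant function. -/
theorem sq_integral_le {f : ℝ → ℝ} (hT : 0 < T) (hf : ContinuousOn f (Icc 0 T)) :
    (∫ t in (0 : ℝ)..T, f t) ^ 2 ≤ T * ∫ t in (0 : ℝ)..T, f t ^ 2 := by
  set I := ∫ t in (0 : ℝ)..T, f t with hI
  have hTm : T ∈ Icc 0 T := ⟨hT.le, le_rfl⟩
  have i1 := intervalIntegrable_of_continuousOn_Icc hf hTm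
  have i2 : IntervalIntegrable (fun t => f t ^ 2) volume 0 T :=
    intervalIntegrable_of_continuousOn_Icc (hf.pow 2) hTm
  have h : 0 ≤ ∫ t in (0 : ℝ)..T, (f t - I / T) ^ 2 :=
    intervalIntegral.integral_nonneg hT.le fun t _ => sq_nonneg _
  have e : ∀ t, (f t - I / T) ^ 2 = f t ^ 2 - 2 * (I / T) * f t + (I / T) ^ 2 := fun t => by ring
  simp only [e] at h
  rw [intervalIntegral.integral_add (i2.sub (i1.const_mul _)) intervalIntegrable_const,
    intervalIntegral.integral_sub i2 (i1.const_mul _), intervalIntegral.integral_const_mul,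
    intervalIntegral.integral_const, ← hI] at h
  have : (∫ t in (0 : ℝ)..T, f t ^ 2) - 2 * (I / T) * I + (T - 0) • (I / T) ^ 2
      = (∫ t in (0 : ℝ)..T, f t ^ 2) - I ^ 2 / T := by
    simp only [smul_eq_mul]; field_simp; ring
  rw [this, sub_nonneg, div_le_iff₀ hT] at h
  linarith

/-- Integration by parts for the primitives of two vector-valued functions, with the boundary term
absorbed in the integral. -/
theorem integral_dotProduct_primitive {ι : Type*} [Fintype ι] {f g : ℝ → ι → ℝ} (hT : 0 ≤ T)
    (hf : ContinuousOn f (Icc 0 T)) (hg : ContinuousOn g (Icc 0 T)) :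
    ∫ t in (0 : ℝ)..T, f t ⬝ᵥ ∫ s in (0 : ℝ)..t, g s
      = ∫ t in (0 : ℝ)..T, ((∫ s in (0 : ℝ)..T, f s) - ∫ s in (0 : ℝ)..t, f s) ⬝ᵥ g t := by
  have hTm : T ∈ Icc 0 T := ⟨hT, le_rfl⟩
  set Λ : ℝ → ι → ℝ := fun t => ∫ s in (0 : ℝ)..t, f s with hΛ
  set ζ : ℝ → ι → ℝ := fun t => ∫ s in (0 : ℝ)..t, g s with hζ
  have cΛ : ContinuousOn Λ (Icc 0 T) := continuousOn_primitive hT hf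
  have cζ : ContinuousOn ζ (Icc 0 T) := continuousOn_primitive hT hg
  have c1 := continuousOn_dotProduct hf cζ
  have c2 : ContinuousOn (fun t => (Λ t - Λ T) ⬝ᵥ g t) (Icc 0 T) :=
    continuousOn_dotProduct (cΛ.sub continuousOn_const) hg
  have c3 : ContinuousOn (fun t => (Λ t - Λ T) ⬝ᵥ ζ t) (Icc 0 T) :=
    continuousOn_dotProduct (cΛ.sub continuousOn_const) cζ
  have i1 := intervalIntegrable_of_continuousOn_Icc c1 hTm
  have i2 := intervalIntegrable_of_continuousOn_Icc c2 hTm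
  have key := intervalIntegral.integral_eq_sub_of_hasDerivAt_of_le
    (f := fun t => (Λ t - Λ T) ⬝ᵥ ζ t) (f' := fun t => f t ⬝ᵥ ζ t + (Λ t - Λ T) ⬝ᵥ g t) hT c3
    (fun t ht => hasDerivAt_dotProduct ((hasDerivAt_primitive hf ht).sub_const (Λ T))
      (hasDerivAt_primitive hg ht)) (i1.add i2)
  rw [intervalIntegral.integral_add i1 i2] at key
  have hζ0 : ζ 0 = 0 := by simp [hζ]
  rw [hζ0] at key
  simp only [sub_self, zero_dotProduct, dotProduct_zero] at key
  change ∫ t in (0 : ℝ)..T, f t ⬝ᵥ ζ t = ∫ t in (0 : ℝ)..T, (Λ T - Λ t) ⬝ᵥ g t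
  rw [eq_neg_of_add_eq_zero_left key, ← intervalIntegral.integral_neg]
  refine intervalIntegral.integral_congr fun t _ => ?_
  simp only [← neg_dotProduct, neg_sub]

end Primitive

/-! ### Linear controlled paths -/

section Paths

variable {ι κ : Type*} [Fintype ι] [Fintype κ] {T : ℝ}

/-- Variation of constants, hence uniqueness, for `z' = A z + w`, `z(0) = 0`. -/
theorem eq_exp_mulVec_integral [DecidableEq ι] (A : Matrix ι ι ℝ) {z w : ℝ → ι → ℝ}
    (hz : ContinuousOn z (Icc 0 T)) (hw : ContinuousOn w (Icc 0 T))
    (h : ∀ t ∈ Icc 0 T, z t = ∫ s in (0 : ℝ)..t, (A *ᵥ z s + w s)) {t : ℝ} (ht : t ∈ Icc 0 T) :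
    z t = NormedSpace.exp (t • A) *ᵥ ∫ s in (0 : ℝ)..t, NormedSpace.exp (-s • A) *ᵥ w s := by
  have hsub : Icc 0 t ⊆ Icc 0 T := Icc_subset_Icc_right ht.2
  have cE : Continuous fun s : ℝ => NormedSpace.exp (-s • A) :=
    (continuous_exp_smul A).comp continuous_neg
  have cA : ContinuousOn (fun s => A *ᵥ z s + w s) (Icc 0 T) :=
    (continuousOn_mulVec continuousOn_const hz).add hw
  have c1 : ContinuousOn (fun s => NormedSpace.exp (-s • A) *ᵥ z s) (Icc 0 T) :=
    continuousOn_mulVec cE.continuousOn hz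
  have c2 : ContinuousOn (fun s => NormedSpace.exp (-s • A) *ᵥ w s) (Icc 0 T) :=
    continuousOn_mulVec cE.continuousOn hw
  have hder : ∀ s ∈ Ioo 0 t, HasDerivAt (fun s => NormedSpace.exp (-s • A) *ᵥ z s)
      (NormedSpace.exp (-s • A) *ᵥ w s) s := by
    intro s hs
    have hs' : s ∈ Ioo 0 T := ⟨hs.1, hs.2.trans_le ht.2⟩
    have dz : HasDerivAt z (A *ᵥ z s + w s) s := by
      refine (hasDerivAt_primitive cA hs').congr_of_eventuallyEq ?_
      filter_upwards [Icc_mem_nhds hs'.1 hs'.2] with u hu using h u hu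
    have dE : ∀ i j, HasDerivAt (fun s : ℝ => NormedSpace.exp (-s • A) i j)
        ((-(NormedSpace.exp (-s • A) * A)) i j) s := fun i j => by
      have := (hasDerivAt_exp_smul_apply A (-s) i j).scomp s (hasDerivAt_neg s)
      simpa [Function.comp_def] using this
    have := hasDerivAt_mulVec dE dz
    convert! this using 1
    rw [Matrix.mulVec_add, Matrix.neg_mulVec, Matrix.mulVec_mulVec]
    abel
  have key := intervalIntegral.integral_eq_sub_of_hasDerivAt_of_le ht.1 (c1.mono hsub) hder
    (intervalIntegrable_of_continuousOn_Icc c2 ht)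
  have h0 : z 0 = 0 := by
    have := h 0 ⟨le_rfl, ht.1.trans ht.2⟩
    simpa using this
  rw [key, h0, Matrix.mulVec_zero, sub_zero, exp_smul_mulVec_exp_neg_smul_mulVec]

/-- The converse of `eq_exp_mulVec_integral`: the variation of constants formula solves
`z' = A z + w`, `z(0) = 0`. -/
theorem exp_mulVec_integral_eq [DecidableEq ι] (A : Matrix ι ι ℝ) {w : ℝ → ι → ℝ} {z : ℝ → ι → ℝ}
    (hw : ContinuousOn w (Icc 0 T))
    (hz : ∀ t, z t = NormedSpace.exp (t • A) *ᵥ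
      ∫ s in (0 : ℝ)..t, NormedSpace.exp (-s • A) *ᵥ w s) {t : ℝ} (ht : t ∈ Icc 0 T) :
    z t = ∫ s in (0 : ℝ)..t, (A *ᵥ z s + w s) := by
  have hT : 0 ≤ T := ht.1.trans ht.2
  have c1 : ContinuousOn (fun s => NormedSpace.exp (-s • A) *ᵥ w s) (Icc 0 T) :=
    continuousOn_mulVec ((continuous_exp_smul A).comp continuous_neg).continuousOn hw
  have cz : ContinuousOn z (Icc 0 T) :=
    (continuousOn_mulVec (continuous_exp_smul A).continuousOn
      (continuousOn_primitive hT c1)).congr fun s _ => hz s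
  have cA : ContinuousOn (fun s => A *ᵥ z s + w s) (Icc 0 T) :=
    (continuousOn_mulVec continuousOn_const cz).add hw
  have hder : ∀ s ∈ Ioo 0 t, HasDerivAt z (A *ᵥ z s + w s) s := by
    intro s hs
    have hd := hasDerivAt_mulVec (hasDerivAt_exp_smul_apply' A s)
      (hasDerivAt_primitive c1 ⟨hs.1, hs.2.trans_le ht.2⟩)
    rw [exp_smul_mulVec_exp_neg_smul_mulVec, ← Matrix.mulVec_mulVec, ← hz s] at hd
    exact hd.congr_of_eventuallyEq (Eventually.of_forall hz)
  have key := intervalIntegral.integral_eq_sub_of_hasDerivAt_of_le ht.1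
    (cz.mono (Icc_subset_Icc_right ht.2)) hder (intervalIntegrable_of_continuousOn_Icc cA ht)
  rw [key, hz 0]
  simp

/-- A positive definite matrix is coercive for the sup norm. -/
theorem exists_pos_mul_sq_norm_le {R : Matrix κ κ ℝ} (hR : R.PosDef) :
    ∃ c > 0, ∀ x, c * ‖x‖ ^ 2 ≤ x ⬝ᵥ R *ᵥ x := by
  have hcont : Continuous fun x : κ → ℝ => x ⬝ᵥ R *ᵥ x :=
    continuousOn_univ.1 (continuousOn_dotProduct continuousOn_id
      (continuousOn_mulVec continuousOn_const continuousOn_id))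
  have hpos : ∀ x : κ → ℝ, x ≠ 0 → 0 < x ⬝ᵥ R *ᵥ x := fun x hx => by
    simpa using hR.dotProduct_mulVec_pos hx
  rcases (Metric.sphere (0 : κ → ℝ) 1).eq_empty_or_nonempty with he | hne
  · -- the unit sphere is empty exactly when `κ` is
    refine ⟨1, one_pos, fun x => ?_⟩
    have hx : x = 0 := by
      by_contra hx
      have : (‖x‖⁻¹ • x) ∈ Metric.sphere (0 : κ → ℝ) 1 := by
        simp [norm_smul, norm_ne_zero_iff.2 hx]
      simp [he] at this
    simp [hx]
  · obtain ⟨x₀, hx₀, hmin⟩ := (isCompact_sphere (0 : κ → ℝ) 1).exists_isMinOn hne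
      hcont.continuousOn
    have hx₀' : x₀ ≠ 0 := by rintro rfl; simp at hx₀
    refine ⟨_, hpos x₀ hx₀', fun x => ?_⟩
    rcases eq_or_ne x 0 with rfl | hx
    · simp
    have hn := norm_ne_zero_iff.2 hx
    have h1 : x₀ ⬝ᵥ R *ᵥ x₀ ≤ (‖x‖⁻¹ • x) ⬝ᵥ R *ᵥ (‖x‖⁻¹ • x) :=
      hmin (by simp [norm_smul, hn] : (‖x‖⁻¹ • x) ∈ Metric.sphere (0 : κ → ℝ) 1)
    rw [Matrix.mulVec_smul, smul_dotProduct, dotProduct_smul, smul_eq_mul, smul_eq_mul] at h1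
    calc _ ≤ (‖x‖⁻¹ * (‖x‖⁻¹ * (x ⬝ᵥ R *ᵥ x))) * ‖x‖ ^ 2 :=
          mul_le_mul_of_nonneg_right h1 (sq_nonneg _)
      _ = _ := by field_simp

/-- The integrand of twice the running cost, as a quadratic form in the error and the control. -/
noncomputable def runQuad (Q : Matrix ι ι ℝ) (S : Matrix ι κ ℝ) (R : Matrix κ κ ℝ)
    (e : ι → ℝ) (u : κ → ℝ) : ℝ :=
  e ⬝ᵥ Q *ᵥ e + 2 * (e ⬝ᵥ S *ᵥ u) + u ⬝ᵥ R *ᵥ u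

/-- The cost of an error path `e` and a control path `u`, before division by `γ`. -/
noncomputable def quadCost (T : ℝ) (Qhat Q : Matrix ι ι ℝ) (S : Matrix ι κ ℝ) (R : Matrix κ κ ℝ)
    (e : ℝ → ι → ℝ) (u : ℝ → κ → ℝ) : ℝ :=
  (1 / 2) * (e T ⬝ᵥ Qhat *ᵥ e T) + ∫ t in (0 : ℝ)..T, (1 / 2) * runQuad Q S R (e t) (u t)

/-- The symmetric bilinear form polarizing `quadCost`: the derivative of the cost at `(e, u)` in
the direction `(z, v)`. -/
noncomputable def quadCostDeriv (T : ℝ) (Qhat Q : Matrix ι ι ℝ) (S : Matrix ι κ ℝ)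
    (R : Matrix κ κ ℝ) (e : ℝ → ι → ℝ) (u : ℝ → κ → ℝ) (z : ℝ → ι → ℝ) (v : ℝ → κ → ℝ) : ℝ :=
  z T ⬝ᵥ Qhat *ᵥ e T
    + ∫ t in (0 : ℝ)..T, (z t ⬝ᵥ (Q *ᵥ e t + S *ᵥ u t) + v t ⬝ᵥ (Sᵀ *ᵥ e t + R *ᵥ u t))

theorem continuousOn_runQuad (Q : Matrix ι ι ℝ) (S : Matrix ι κ ℝ) (R : Matrix κ κ ℝ)
    {e : ℝ → ι → ℝ} {u : ℝ → κ → ℝ} {s : Set ℝ} (he : ContinuousOn e s) (hu : ContinuousOn u s) :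
    ContinuousOn (fun t => runQuad Q S R (e t) (u t)) s :=
  ((continuousOn_dotProduct he (continuousOn_mulVec continuousOn_const he)).add
    (continuousOn_const.mul (continuousOn_dotProduct he
      (continuousOn_mulVec continuousOn_const hu)))).add
    (continuousOn_dotProduct hu (continuousOn_mulVec continuousOn_const hu))

theorem dotProduct_mulVec_comm (M : Matrix ι κ ℝ) (x : ι → ℝ) (y : κ → ℝ) :
    x ⬝ᵥ M *ᵥ y = y ⬝ᵥ Mᵀ *ᵥ x := by
  rw [Matrix.dotProduct_mulVec, dotProduct_comm, Matrix.mulVec_transpose]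

theorem dotProduct_mulVec_symm {M : Matrix ι ι ℝ} (hM : M.IsSymm) (x y : ι → ℝ) :
    x ⬝ᵥ M *ᵥ y = y ⬝ᵥ M *ᵥ x := by
  rw [dotProduct_mulVec_comm, hM.eq]

theorem runQuad_add_smul {Q : Matrix ι ι ℝ} (S : Matrix ι κ ℝ) {R : Matrix κ κ ℝ}
    (hQ : Q.IsSymm) (hR : R.IsSymm) (e z : ι → ℝ) (u v : κ → ℝ) (ε : ℝ) :
    runQuad Q S R (e + ε • z) (u + ε • v) = runQuad Q S R e u
      + ε * (2 * (z ⬝ᵥ (Q *ᵥ e + S *ᵥ u) + v ⬝ᵥ (Sᵀ *ᵥ e + R *ᵥ u)))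
      + ε ^ 2 * runQuad Q S R z v := by
  simp only [runQuad, Matrix.mulVec_add, Matrix.mulVec_smul, add_dotProduct, dotProduct_add,
    smul_dotProduct, dotProduct_smul, smul_eq_mul]
  rw [dotProduct_mulVec_symm hQ e z, dotProduct_mulVec_symm hR u v, dotProduct_mulVec_comm S e v]
  ring

theorem quadCost_add_smul {Qhat Q : Matrix ι ι ℝ} (S : Matrix ι κ ℝ) {R : Matrix κ κ ℝ}
    (hT : 0 ≤ T) (hQhat : Qhat.IsSymm) (hQ : Q.IsSymm) (hR : R.IsSymm)
    {e z : ℝ → ι → ℝ} {u v : ℝ → κ → ℝ}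
    (he : ContinuousOn e (Icc 0 T)) (hz : ContinuousOn z (Icc 0 T))
    (hu : ContinuousOn u (Icc 0 T)) (hv : ContinuousOn v (Icc 0 T)) (ε : ℝ) :
    quadCost T Qhat Q S R (fun t => e t + ε • z t) (fun t => u t + ε • v t)
      = quadCost T Qhat Q S R e u + ε * quadCostDeriv T Qhat Q S R e u z v
        + ε ^ 2 * quadCost T Qhat Q S R z v := by
  have hTm : T ∈ Icc 0 T := ⟨hT, le_rfl⟩
  have i1 := intervalIntegrable_of_continuousOn_Icc (continuousOn_runQuad Q S R he hu) hTm
  have i2 := intervalIntegrable_of_continuousOn_Icc (continuousOn_runQuad Q S R hz hv) hTm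
  have i3 : IntervalIntegrable (fun t => z t ⬝ᵥ (Q *ᵥ e t + S *ᵥ u t)
      + v t ⬝ᵥ (Sᵀ *ᵥ e t + R *ᵥ u t)) volume 0 T :=
    intervalIntegrable_of_continuousOn_Icc
      ((continuousOn_dotProduct hz ((continuousOn_mulVec continuousOn_const he).add
        (continuousOn_mulVec continuousOn_const hu))).add
      (continuousOn_dotProduct hv ((continuousOn_mulVec continuousOn_const he).add
        (continuousOn_mulVec continuousOn_const hu)))) hTm
  have h1 : ∀ t, (1 / 2) * runQuad Q S R (e t + ε • z t) (u t + ε • v t)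
      = (1 / 2) * runQuad Q S R (e t) (u t)
        + ε * (z t ⬝ᵥ (Q *ᵥ e t + S *ᵥ u t) + v t ⬝ᵥ (Sᵀ *ᵥ e t + R *ᵥ u t))
        + ε ^ 2 * ((1 / 2) * runQuad Q S R (z t) (v t)) := fun t => by
    rw [runQuad_add_smul S hQ hR]; ring
  have h2 : (e T + ε • z T) ⬝ᵥ Qhat *ᵥ (e T + ε • z T) = e T ⬝ᵥ Qhat *ᵥ e T
      + 2 * ε * (z T ⬝ᵥ Qhat *ᵥ e T) + ε ^ 2 * (z T ⬝ᵥ Qhat *ᵥ z T) := by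
    simp only [Matrix.mulVec_add, Matrix.mulVec_smul, add_dotProduct, dotProduct_add,
      smul_dotProduct, dotProduct_smul, smul_eq_mul]
    rw [dotProduct_mulVec_symm hQhat (e T) (z T)]
    ring
  simp only [quadCost, quadCostDeriv, h1, h2]
  rw [intervalIntegral.integral_add ((i1.const_mul _).add (i3.const_mul _))
      ((i2.const_mul _).const_mul _),
    intervalIntegral.integral_add (i1.const_mul _) (i3.const_mul _),
    intervalIntegral.integral_const_mul ε, intervalIntegral.integral_const_mul (ε ^ 2)]
  ring

/-- Completing the square in the control. -/
theorem runQuad_eq_completed [DecidableEq κ] (Q : Matrix ι ι ℝ) (S : Matrix ι κ ℝ)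
    {R : Matrix κ κ ℝ} (hRs : R.IsSymm) (hR : R.PosDef) (z : ι → ℝ) (v : κ → ℝ) :
    runQuad Q S R z v = z ⬝ᵥ (Q - S * R⁻¹ * Sᵀ) *ᵥ z
      + (v + R⁻¹ *ᵥ (Sᵀ *ᵥ z)) ⬝ᵥ R *ᵥ (v + R⁻¹ *ᵥ (Sᵀ *ᵥ z)) := by
  have hdet : IsUnit R.det := (Matrix.isUnit_iff_isUnit_det R).1 hR.isUnit
  have h1 : R *ᵥ (R⁻¹ *ᵥ (Sᵀ *ᵥ z)) = Sᵀ *ᵥ z := by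
    rw [Matrix.mulVec_mulVec, Matrix.mul_nonsing_inv _ hdet, Matrix.one_mulVec]
  have h2 : (S * R⁻¹ * Sᵀ) *ᵥ z = S *ᵥ (R⁻¹ *ᵥ (Sᵀ *ᵥ z)) := by
    simp only [Matrix.mulVec_mulVec, Matrix.mul_assoc]
  rw [Matrix.sub_mulVec, h2, Matrix.mulVec_add, h1]
  generalize hy : R⁻¹ *ᵥ (Sᵀ *ᵥ z) = y at *
  simp only [runQuad, add_dotProduct, dotProduct_add, dotProduct_sub]
  rw [dotProduct_mulVec_symm hRs y v, h1, dotProduct_mulVec_comm S z y,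
    dotProduct_mulVec_comm S z v]
  ring

/-- Under the convexity condition the cost controls the energy of the control. After completing the
square, the cost is bounded below by the energy of `v + R⁻¹ Sᵀ z`; the path `z` is a linear
functional of that process, and so `v` is recovered from it. -/
theorem exists_pos_mul_integral_sq_norm_le_quadCost [DecidableEq ι] [DecidableEq κ]
    (hT : 0 < T) (A : Matrix ι ι ℝ)
    (B : Matrix ι κ ℝ) {Qhat Q : Matrix ι ι ℝ} {S : Matrix ι κ ℝ} {R : Matrix κ κ ℝ}
    (hRs : R.IsSymm) (hQhat : Qhat.PosSemidef) (hR : R.PosDef)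
    (hQ : (Q - S * R⁻¹ * Sᵀ).PosSemidef) :
    ∃ c > 0, ∀ (z : ℝ → ι → ℝ) (v : ℝ → κ → ℝ), ContinuousOn z (Icc 0 T) →
      ContinuousOn v (Icc 0 T) →
      (∀ t ∈ Icc 0 T, z t = ∫ s in (0 : ℝ)..t, (A *ᵥ z s + B *ᵥ v s)) →
      c * ∫ t in (0 : ℝ)..T, ‖v t‖ ^ 2 ≤ quadCost T Qhat Q S R z v := by
  obtain ⟨c₀, hc₀, hcR⟩ := exists_pos_mul_sq_norm_le hR
  obtain ⟨C₂, hC₂, hK⟩ := exists_norm_mulVec_le (R⁻¹ * Sᵀ)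
  obtain ⟨CB, hCB, hB⟩ := exists_norm_mulVec_le B
  -- in terms of the completed control `w`, the path solves `z' = A' z + B w`
  set A' := A - B * (R⁻¹ * Sᵀ) with hA'
  obtain ⟨CE, hCE, hE⟩ := exists_norm_exp_smul_mulVec_le A' T
  set C₁ := CE * (CE * CB) with hC₁
  have hC₁0 : 0 ≤ C₁ := by positivity
  set D := 2 + 2 * C₂ ^ 2 * C₁ ^ 2 * T ^ 2 with hD
  have hDpos : 0 < D := by positivity
  refine ⟨c₀ / 2 / D, by positivity, fun z v hz hv h => ?_⟩
  have hTm : T ∈ Icc 0 T := ⟨hT.le, le_rfl⟩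
  set w : ℝ → κ → ℝ := fun t => v t + R⁻¹ *ᵥ (Sᵀ *ᵥ z t) with hw
  have cw : ContinuousOn w (Icc 0 T) := hv.add (continuousOn_mulVec continuousOn_const
    (continuousOn_mulVec continuousOn_const hz))
  have cBw : ContinuousOn (fun t => B *ᵥ w t) (Icc 0 T) := continuousOn_mulVec continuousOn_const cw
  have hz' : ∀ t ∈ Icc 0 T, z t = ∫ s in (0 : ℝ)..t, (A' *ᵥ z s + B *ᵥ w s) := by
    intro t ht
    rw [h t ht]
    refine intervalIntegral.integral_congr fun s _ => ?_
    simp only [hA', hw, Matrix.sub_mulVec, Matrix.mulVec_add, Matrix.mulVec_mulVec]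
    abel
  have cw1 : ContinuousOn (fun t => ‖w t‖) (Icc 0 T) := cw.norm
  have iw1 := intervalIntegrable_of_continuousOn_Icc cw1 hTm
  have iw2 : IntervalIntegrable (fun t => ‖w t‖ ^ 2) volume 0 T :=
    intervalIntegrable_of_continuousOn_Icc (cw1.pow 2) hTm
  set I := ∫ t in (0 : ℝ)..T, ‖w t‖ with hI
  set J := ∫ t in (0 : ℝ)..T, ‖w t‖ ^ 2 with hJ
  have hIJ : I ^ 2 ≤ T * J := sq_integral_le hT cw1
  have hI0 : 0 ≤ I := intervalIntegral.integral_nonneg hT.le fun t _ => norm_nonneg _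
  have hzb : ∀ t ∈ Icc 0 T, ‖z t‖ ≤ C₁ * I := by
    intro t ht
    rw [eq_exp_mulVec_integral A' hz cBw hz' ht]
    refine (hE t ⟨by linarith [ht.1], ht.2⟩ _).trans ?_
    rw [hC₁, mul_assoc]
    refine mul_le_mul_of_nonneg_left ?_ hCE
    calc ‖∫ s in (0 : ℝ)..t, NormedSpace.exp (-s • A') *ᵥ (B *ᵥ w s)‖
        ≤ ∫ s in (0 : ℝ)..t, (CE * CB) * ‖w s‖ := by
          refine intervalIntegral.norm_integral_le_of_norm_le ht.1 ?_
            ((intervalIntegrable_of_continuousOn_Icc cw1 ht).const_mul _)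
          refine ae_of_all _ fun s hs => ?_
          refine (hE (-s) ⟨by linarith [hs.2, ht.2], by linarith [hs.1]⟩ _).trans ?_
          rw [mul_assoc]
          exact mul_le_mul_of_nonneg_left (hB _) hCE
      _ = (CE * CB) * ∫ s in (0 : ℝ)..t, ‖w s‖ := intervalIntegral.integral_const_mul _ _
      _ ≤ (CE * CB) * I := by
          refine mul_le_mul_of_nonneg_left ?_ (by positivity)
          exact intervalIntegral.integral_mono_interval le_rfl ht.1 ht.2
            (ae_of_all _ fun _ => norm_nonneg _) iw1
  have hvb : ∀ t ∈ Icc 0 T, ‖v t‖ ^ 2 ≤ 2 * ‖w t‖ ^ 2 + 2 * C₂ ^ 2 * C₁ ^ 2 * I ^ 2 := by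
    intro t ht
    have h1 : ‖v t‖ ≤ ‖w t‖ + C₂ * (C₁ * I) := by
      have : v t = w t - (R⁻¹ * Sᵀ) *ᵥ z t := by
        simp only [hw, Matrix.mulVec_mulVec]; abel
      rw [this]
      exact (norm_sub_le _ _).trans (add_le_add le_rfl ((hK _).trans
        (mul_le_mul_of_nonneg_left (hzb t ht) hC₂)))
    have h2 : ‖v t‖ ^ 2 ≤ (‖w t‖ + C₂ * (C₁ * I)) ^ 2 :=
      pow_le_pow_left₀ (norm_nonneg _) h1 2
    nlinarith [sq_nonneg (‖w t‖ - C₂ * (C₁ * I))]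
  have hV : ∫ t in (0 : ℝ)..T, ‖v t‖ ^ 2 ≤ D * J := by
    calc ∫ t in (0 : ℝ)..T, ‖v t‖ ^ 2
        ≤ ∫ t in (0 : ℝ)..T, (2 * ‖w t‖ ^ 2 + 2 * C₂ ^ 2 * C₁ ^ 2 * I ^ 2) :=
          intervalIntegral.integral_mono_on hT.le
            (intervalIntegrable_of_continuousOn_Icc (hv.norm.pow 2) hTm)
            ((iw2.const_mul 2).add intervalIntegrable_const) hvb
      _ = 2 * J + T * (2 * C₂ ^ 2 * C₁ ^ 2 * I ^ 2) := by
          rw [intervalIntegral.integral_add (iw2.const_mul 2) intervalIntegrable_const,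
            intervalIntegral.integral_const_mul, intervalIntegral.integral_const, smul_eq_mul,
            sub_zero]
      _ ≤ 2 * J + T * (2 * C₂ ^ 2 * C₁ ^ 2 * (T * J)) := by gcongr
      _ = D * J := by rw [hD]; ring
  have hrun : c₀ / 2 * J ≤ ∫ t in (0 : ℝ)..T, (1 / 2) * runQuad Q S R (z t) (v t) := by
    rw [hJ, ← intervalIntegral.integral_const_mul]
    refine intervalIntegral.integral_mono_on hT.le (iw2.const_mul _)
      ((intervalIntegrable_of_continuousOn_Icc (continuousOn_runQuad Q S R hz hv) hTm).const_mul _)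
      fun t _ => ?_
    rw [runQuad_eq_completed Q S hRs hR]
    have h1 := hcR (w t)
    have h2 : 0 ≤ z t ⬝ᵥ (Q - S * R⁻¹ * Sᵀ) *ᵥ z t := by
      simpa using hQ.dotProduct_mulVec_nonneg (z t)
    simp only [hw] at h1 ⊢
    linarith
  have hterm : 0 ≤ z T ⬝ᵥ Qhat *ᵥ z T := by simpa using hQhat.dotProduct_mulVec_nonneg (z T)
  calc c₀ / 2 / D * ∫ t in (0 : ℝ)..T, ‖v t‖ ^ 2 ≤ c₀ / 2 / D * (D * J) := by gcongr
    _ = c₀ / 2 * J := by field_simp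
    _ ≤ _ := by unfold quadCost; linarith

theorem integral_exp_sub_smul_mulVec [DecidableEq ι] (A : Matrix ι ι ℝ) {q : ℝ → ι → ℝ}
    (hq : ContinuousOn q (Icc 0 T)) {t : ℝ} (ht : t ∈ Icc 0 T) :
    ∫ s in (0 : ℝ)..t, NormedSpace.exp ((s - t) • A) *ᵥ q s
      = NormedSpace.exp (-t • A) *ᵥ ∫ s in (0 : ℝ)..t, NormedSpace.exp (s • A) *ᵥ q s := by
  let L := LinearMap.toContinuousLinearMap (Matrix.mulVecLin (NormedSpace.exp (-t • A)))
  have := L.intervalIntegral_comp_comm (intervalIntegrable_of_continuousOn_Icc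
    (continuousOn_mulVec (continuous_exp_smul A).continuousOn hq) ht)
  refine Eq.trans (intervalIntegral.integral_congr fun s _ => ?_) this
  change _ = NormedSpace.exp (-t • A) *ᵥ (NormedSpace.exp (s • A) *ᵥ q s)
  rw [← exp_add_smul_mulVec, sub_eq_neg_add]

/-- The random vector `e^{Aᵀ T} Q̂ e_T + ∫₀ᵀ e^{Aᵀ s} (Q e_s + S u_s) ds` along one path. -/
noncomputable def adjointTerminal [DecidableEq ι] (T : ℝ) (A Qhat Q : Matrix ι ι ℝ)
    (S : Matrix ι κ ℝ) (e : ℝ → ι → ℝ) (u : ℝ → κ → ℝ) : ι → ℝ :=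
  NormedSpace.exp (T • Aᵀ) *ᵥ (Qhat *ᵥ e T)
    + ∫ s in (0 : ℝ)..T, NormedSpace.exp (s • Aᵀ) *ᵥ (Q *ᵥ e s + S *ᵥ u s)

/-- The part of the gradient of the cost at time `t` which depends on the path up to `t` only. -/
noncomputable def adjointControl [DecidableEq ι] (A : Matrix ι ι ℝ) (B : Matrix ι κ ℝ)
    (Q : Matrix ι ι ℝ) (S : Matrix ι κ ℝ) (R : Matrix κ κ ℝ) (e : ℝ → ι → ℝ) (u : ℝ → κ → ℝ)
    (t : ℝ) : κ → ℝ :=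
  Sᵀ *ᵥ e t + R *ᵥ u t
    - Bᵀ *ᵥ ∫ s in (0 : ℝ)..t, NormedSpace.exp ((s - t) • Aᵀ) *ᵥ (Q *ᵥ e s + S *ᵥ u s)

/-- Duality: when `z` is the response to the control `v`, the derivative of the cost is an integral
against `v`, the adjoint variable being obtained by integration by parts. -/
theorem quadCostDeriv_eq_integral [DecidableEq ι] (hT : 0 ≤ T) (A : Matrix ι ι ℝ) (B : Matrix ι κ ℝ)
    (Qhat Q : Matrix ι ι ℝ) (S : Matrix ι κ ℝ) (R : Matrix κ κ ℝ)
    {e z : ℝ → ι → ℝ} {u v : ℝ → κ → ℝ}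
    (he : ContinuousOn e (Icc 0 T)) (hu : ContinuousOn u (Icc 0 T))
    (hv : ContinuousOn v (Icc 0 T))
    (hz : ∀ t ∈ Icc 0 T, z t = NormedSpace.exp (t • A) *ᵥ
      ∫ s in (0 : ℝ)..t, NormedSpace.exp (-s • A) *ᵥ (B *ᵥ v s)) :
    quadCostDeriv T Qhat Q S R e u z v = ∫ t in (0 : ℝ)..T,
      (v t ⬝ᵥ adjointControl A B Q S R e u t
        + (NormedSpace.exp (-t • A) *ᵥ (B *ᵥ v t)) ⬝ᵥ adjointTerminal T A Qhat Q S e u) := by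
  have hTm : T ∈ Icc 0 T := ⟨hT, le_rfl⟩
  have cE (M : Matrix ι ι ℝ) : Continuous fun s : ℝ => NormedSpace.exp (-s • M) :=
    (continuous_exp_smul M).comp continuous_neg
  set q : ℝ → ι → ℝ := fun s => Q *ᵥ e s + S *ᵥ u s with hq
  have cq : ContinuousOn q (Icc 0 T) := (continuousOn_mulVec continuousOn_const he).add
    (continuousOn_mulVec continuousOn_const hu)
  set f : ℝ → ι → ℝ := fun s => NormedSpace.exp (s • Aᵀ) *ᵥ q s with hf
  have cf : ContinuousOn f (Icc 0 T) :=
    continuousOn_mulVec (continuous_exp_smul _).continuousOn cq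
  set g : ℝ → ι → ℝ := fun s => NormedSpace.exp (-s • A) *ᵥ (B *ᵥ v s) with hg
  have cg : ContinuousOn g (Icc 0 T) := continuousOn_mulVec (cE A).continuousOn
    (continuousOn_mulVec continuousOn_const hv)
  set ζ : ℝ → ι → ℝ := fun t => ∫ s in (0 : ℝ)..t, g s with hζ
  have cζ : ContinuousOn ζ (Icc 0 T) := continuousOn_primitive hT cg
  set Λ : ℝ → ι → ℝ := fun t => ∫ s in (0 : ℝ)..t, f s with hΛ
  have cΛ : ContinuousOn Λ (Icc 0 T) := continuousOn_primitive hT cf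
  set θ := NormedSpace.exp (T • Aᵀ) *ᵥ (Qhat *ᵥ e T) with hθ
  set c : ℝ → κ → ℝ := fun t => Sᵀ *ᵥ e t + R *ᵥ u t with hc
  have cc : ContinuousOn c (Icc 0 T) := (continuousOn_mulVec continuousOn_const he).add
    (continuousOn_mulVec continuousOn_const hu)
  -- the terminal cost and the state part of the running cost, in terms of `ζ`
  have hterm : z T ⬝ᵥ Qhat *ᵥ e T = ∫ t in (0 : ℝ)..T, θ ⬝ᵥ g t := by
    rw [hz T hTm, dotProduct_comm, dotProduct_exp_smul_mulVec]
    let L := LinearMap.toContinuousLinearMap (dotProductBilin ℝ ℝ θ)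
    exact (L.intervalIntegral_comp_comm (intervalIntegrable_of_continuousOn_Icc cg hTm)).symm
  have hrun : ∀ t ∈ Icc 0 T, z t ⬝ᵥ q t = f t ⬝ᵥ ζ t := fun t ht => by
    rw [hz t ht, dotProduct_comm, dotProduct_exp_smul_mulVec]
  have hadj : ∀ t ∈ Icc 0 T, v t ⬝ᵥ (c t
      - Bᵀ *ᵥ ∫ s in (0 : ℝ)..t, NormedSpace.exp ((s - t) • Aᵀ) *ᵥ q s)
      = v t ⬝ᵥ c t - Λ t ⬝ᵥ g t := by
    intro t ht
    rw [integral_exp_sub_smul_mulVec Aᵀ cq ht, dotProduct_sub, ← dotProduct_mulVec_comm,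
      ← dotProduct_exp_smul_mulVec]
  have c1 : ContinuousOn (fun t => v t ⬝ᵥ c t) (Icc 0 T) := continuousOn_dotProduct hv cc
  have c2 : ContinuousOn (fun t => f t ⬝ᵥ ζ t) (Icc 0 T) := continuousOn_dotProduct cf cζ
  have c3 : ContinuousOn (fun t => (Λ T - Λ t) ⬝ᵥ g t) (Icc 0 T) :=
    continuousOn_dotProduct (continuousOn_const.sub cΛ) cg
  have c4 : ContinuousOn (fun t => θ ⬝ᵥ g t) (Icc 0 T) :=
    continuousOn_dotProduct continuousOn_const cg
  have ii {φ : ℝ → ℝ} (h : ContinuousOn φ (Icc 0 T)) := intervalIntegrable_of_continuousOn_Icc h hTm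
  calc quadCostDeriv T Qhat Q S R e u z v
      = (∫ t in (0 : ℝ)..T, θ ⬝ᵥ g t) + ∫ t in (0 : ℝ)..T, (f t ⬝ᵥ ζ t + v t ⬝ᵥ c t) := by
        rw [quadCostDeriv, hterm]
        congr 1
        refine intervalIntegral.integral_congr fun t ht => ?_
        rw [uIcc_of_le hT] at ht
        change z t ⬝ᵥ q t + _ = _
        rw [hrun t ht]
    _ = (∫ t in (0 : ℝ)..T, θ ⬝ᵥ g t) + ((∫ t in (0 : ℝ)..T, (Λ T - Λ t) ⬝ᵥ g t)
          + ∫ t in (0 : ℝ)..T, v t ⬝ᵥ c t) := by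
        rw [intervalIntegral.integral_add (ii c2) (ii c1), integral_dotProduct_primitive hT cf cg]
    _ = ∫ t in (0 : ℝ)..T, (θ ⬝ᵥ g t + ((Λ T - Λ t) ⬝ᵥ g t + v t ⬝ᵥ c t)) := by
        rw [intervalIntegral.integral_add (ii c4) ((ii c3).add (ii c1)),
          intervalIntegral.integral_add (ii c3) (ii c1)]
    _ = _ := by
        refine intervalIntegral.integral_congr fun t ht => ?_
        rw [uIcc_of_le hT] at ht
        change _ = v t ⬝ᵥ (c t - Bᵀ *ᵥ ∫ s in (0 : ℝ)..t,
          NormedSpace.exp ((s - t) • Aᵀ) *ᵥ q s) + g t ⬝ᵥ (θ + Λ T)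
        rw [hadj t ht, dotProduct_comm (g t), add_dotProduct, sub_dotProduct]
        ring

/-- The two vectors paired with the control in `quadCostDeriv_eq_integral` are bounded by the
energy of the error and the control. -/
theorem exists_sq_norm_adjoint_le [DecidableEq ι] (hT : 0 < T) (A : Matrix ι ι ℝ)
    (B : Matrix ι κ ℝ) (Qhat Q : Matrix ι ι ℝ) (S : Matrix ι κ ℝ) (R : Matrix κ κ ℝ) :
    ∃ C, 0 ≤ C ∧ ∀ (e : ℝ → ι → ℝ) (u : ℝ → κ → ℝ), ContinuousOn e (Icc 0 T) →
      ContinuousOn u (Icc 0 T) →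
      ‖adjointTerminal T A Qhat Q S e u‖ ^ 2
        ≤ C * (e T ⬝ᵥ e T + ∫ t in (0 : ℝ)..T, (e t ⬝ᵥ e t + u t ⬝ᵥ u t)) ∧
      ∀ t ∈ Icc 0 T, ‖adjointControl A B Q S R e u t‖ ^ 2
          ≤ C * ((e t ⬝ᵥ e t + u t ⬝ᵥ u t)
            + (e T ⬝ᵥ e T + ∫ t in (0 : ℝ)..T, (e t ⬝ᵥ e t + u t ⬝ᵥ u t))) := by
  obtain ⟨CE, hCE, hE⟩ := exists_norm_exp_smul_mulVec_le Aᵀ T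
  obtain ⟨C₁, hC₁, h₁⟩ := exists_norm_mulVec_le Qhat
  obtain ⟨C₂, hC₂, h₂⟩ := exists_norm_mulVec_le Q
  obtain ⟨C₃, hC₃, h₃⟩ := exists_norm_mulVec_le S
  obtain ⟨C₄, hC₄, h₄⟩ := exists_norm_mulVec_le Sᵀ
  obtain ⟨C₅, hC₅, h₅⟩ := exists_norm_mulVec_le R
  obtain ⟨C₆, hC₆, h₆⟩ := exists_norm_mulVec_le Bᵀ
  set a := CE * (C₂ + C₃) with ha
  have ha0 : 0 ≤ a := by positivity
  set C := 2 * (CE * C₁) ^ 2 + 4 * T * a ^ 2 + 4 * C₄ ^ 2 + 4 * C₅ ^ 2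
    + 4 * T * (C₆ * a) ^ 2 with hC
  have hCp1 : 2 * (CE * C₁) ^ 2 + 4 * T * a ^ 2 ≤ C := by
    have : 0 ≤ 4 * C₄ ^ 2 + 4 * C₅ ^ 2 + 4 * T * (C₆ * a) ^ 2 := by positivity
    linarith
  have hCp2 : 4 * C₄ ^ 2 + 4 * C₅ ^ 2 + 4 * T * (C₆ * a) ^ 2 ≤ C := by
    have : 0 ≤ 2 * (CE * C₁) ^ 2 + 4 * T * a ^ 2 := by positivity
    linarith
  refine ⟨C, by positivity, fun e u he hu => ?_⟩
  have hTm : T ∈ Icc 0 T := ⟨hT.le, le_rfl⟩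
  set ρ : ℝ → ℝ := fun t => e t ⬝ᵥ e t + u t ⬝ᵥ u t with hρ
  have cρ : ContinuousOn ρ (Icc 0 T) :=
    (continuousOn_dotProduct he he).add (continuousOn_dotProduct hu hu)
  have hρ0 : ∀ t, ‖e t‖ ^ 2 + ‖u t‖ ^ 2 ≤ ρ t := fun t =>
    add_le_add (sq_norm_le_dotProduct _) (sq_norm_le_dotProduct _)
  set I := ∫ t in (0 : ℝ)..T, ρ t with hI
  have hI0 : 0 ≤ I := intervalIntegral.integral_nonneg hT.le fun t _ =>
    le_trans (by positivity) (hρ0 t)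
  have hn : ContinuousOn (fun t => ‖e t‖ + ‖u t‖) (Icc 0 T) := he.norm.add hu.norm
  set W := ∫ t in (0 : ℝ)..T, (‖e t‖ + ‖u t‖) with hW
  have hW0 : 0 ≤ W := intervalIntegral.integral_nonneg hT.le fun t _ => by positivity
  have hW2 : W ^ 2 ≤ 2 * T * I := by
    refine (sq_integral_le hT hn).trans ?_
    rw [mul_comm 2 T, mul_assoc]
    refine mul_le_mul_of_nonneg_left ?_ hT.le
    rw [hI, ← intervalIntegral.integral_const_mul]
    refine intervalIntegral.integral_mono_on hT.le
      (intervalIntegrable_of_continuousOn_Icc (hn.pow 2) hTm)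
      ((intervalIntegrable_of_continuousOn_Icc cρ hTm).const_mul 2) fun t _ => ?_
    nlinarith [hρ0 t, sq_nonneg (‖e t‖ - ‖u t‖)]
  have hq : ∀ s, ‖Q *ᵥ e s + S *ᵥ u s‖ ≤ (C₂ + C₃) * (‖e s‖ + ‖u s‖) := fun s => by
    refine (norm_add_le _ _).trans ((add_le_add (h₂ _) (h₃ _)).trans ?_)
    nlinarith [mul_nonneg hC₂ (norm_nonneg (u s)), mul_nonneg hC₃ (norm_nonneg (e s))]
  have hint : ∀ t ∈ Icc 0 T, ∀ φ : ℝ → ℝ, (∀ s ∈ Icc 0 t, φ s ∈ Icc (-T) T) →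
      ‖∫ s in (0 : ℝ)..t, NormedSpace.exp (φ s • Aᵀ) *ᵥ (Q *ᵥ e s + S *ᵥ u s)‖ ≤ a * W := by
    intro t ht φ hφ
    calc ‖∫ s in (0 : ℝ)..t, NormedSpace.exp (φ s • Aᵀ) *ᵥ (Q *ᵥ e s + S *ᵥ u s)‖
        ≤ ∫ s in (0 : ℝ)..t, a * (‖e s‖ + ‖u s‖) := by
          refine intervalIntegral.norm_integral_le_of_norm_le ht.1 ?_
            ((intervalIntegrable_of_continuousOn_Icc hn ht).const_mul _)
          refine ae_of_all _ fun s hs => ?_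
          refine (hE _ (hφ s ⟨hs.1.le, hs.2⟩) _).trans ?_
          rw [ha, mul_assoc]
          exact mul_le_mul_of_nonneg_left (hq s) hCE
      _ = a * ∫ s in (0 : ℝ)..t, (‖e s‖ + ‖u s‖) := intervalIntegral.integral_const_mul _ _
      _ ≤ a * W := by
          refine mul_le_mul_of_nonneg_left ?_ ha0
          exact intervalIntegral.integral_mono_interval le_rfl ht.1 ht.2
            (ae_of_all _ fun _ => by positivity) (intervalIntegrable_of_continuousOn_Icc hn hTm)
  have heT : ‖e T‖ ^ 2 ≤ e T ⬝ᵥ e T := sq_norm_le_dotProduct _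
  have heT0 : 0 ≤ e T ⬝ᵥ e T := le_trans (sq_nonneg _) heT
  have haW : (a * W) ^ 2 ≤ a ^ 2 * (2 * T * I) := by
    rw [mul_pow]; exact mul_le_mul_of_nonneg_left hW2 (sq_nonneg _)
  constructor
  · have hb : ‖NormedSpace.exp (T • Aᵀ) *ᵥ (Qhat *ᵥ e T)
        + ∫ s in (0 : ℝ)..T, NormedSpace.exp (s • Aᵀ) *ᵥ (Q *ᵥ e s + S *ᵥ u s)‖
        ≤ CE * C₁ * ‖e T‖ + a * W := by
      refine (norm_add_le _ _).trans (add_le_add ?_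
        (hint T hTm (fun s => s) fun s hs => ⟨by linarith [hs.1, hT], hs.2⟩))
      refine (hE T ⟨by linarith, le_rfl⟩ _).trans ?_
      rw [mul_assoc]
      exact mul_le_mul_of_nonneg_left (h₁ _) hCE
    calc _ ≤ (CE * C₁ * ‖e T‖ + a * W) ^ 2 := pow_le_pow_left₀ (norm_nonneg _) hb 2
      _ ≤ 2 * ((CE * C₁) ^ 2 * ‖e T‖ ^ 2) + 2 * (a * W) ^ 2 := by
          nlinarith [sq_nonneg (CE * C₁ * ‖e T‖ - a * W)]
      _ ≤ 2 * ((CE * C₁) ^ 2 * (e T ⬝ᵥ e T)) + 2 * (a ^ 2 * (2 * T * I)) := by gcongr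
      _ ≤ (2 * (CE * C₁) ^ 2 + 4 * T * a ^ 2) * (e T ⬝ᵥ e T + I) := by
          have : 0 ≤ 2 * (CE * C₁) ^ 2 * I + 4 * T * a ^ 2 * (e T ⬝ᵥ e T) := by positivity
          linarith
      _ ≤ C * (e T ⬝ᵥ e T + I) := by gcongr
  · intro t ht
    have hρt : 0 ≤ ρ t := le_trans (by positivity) (hρ0 t)
    have hb : ‖Sᵀ *ᵥ e t + R *ᵥ u t - Bᵀ *ᵥ ∫ s in (0 : ℝ)..t,
        NormedSpace.exp ((s - t) • Aᵀ) *ᵥ (Q *ᵥ e s + S *ᵥ u s)‖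
        ≤ C₄ * ‖e t‖ + C₅ * ‖u t‖ + C₆ * (a * W) := by
      refine (norm_sub_le _ _).trans (add_le_add ((norm_add_le _ _).trans
        (add_le_add (h₄ _) (h₅ _))) ((h₆ _).trans (mul_le_mul_of_nonneg_left ?_ hC₆)))
      exact hint t ht (fun s => s - t) fun s hs =>
        ⟨by linarith [hs.1, ht.2], by linarith [hs.2, hT]⟩
    calc _ ≤ (C₄ * ‖e t‖ + C₅ * ‖u t‖ + C₆ * (a * W)) ^ 2 :=
          pow_le_pow_left₀ (norm_nonneg _) hb 2
      _ ≤ 4 * (C₄ ^ 2 * ‖e t‖ ^ 2) + 4 * (C₅ ^ 2 * ‖u t‖ ^ 2) + 2 * (C₆ ^ 2 * (a * W) ^ 2) := by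
          nlinarith [sq_nonneg (C₄ * ‖e t‖ - C₅ * ‖u t‖),
            sq_nonneg (C₄ * ‖e t‖ + C₅ * ‖u t‖ - C₆ * (a * W))]
      _ ≤ 4 * (C₄ ^ 2 * ρ t) + 4 * (C₅ ^ 2 * ρ t) + 2 * (C₆ ^ 2 * (a ^ 2 * (2 * T * I))) := by
          gcongr
          · exact (le_add_of_nonneg_right (sq_nonneg _)).trans (hρ0 t)
          · exact (le_add_of_nonneg_left (sq_nonneg _)).trans (hρ0 t)
      _ ≤ (4 * C₄ ^ 2 + 4 * C₅ ^ 2 + 4 * T * (C₆ * a) ^ 2) * (ρ t + (e T ⬝ᵥ e T + I)) := by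
          have h1 : 0 ≤ (4 * C₄ ^ 2 + 4 * C₅ ^ 2) * (e T ⬝ᵥ e T + I) := by positivity
          have h2 : 0 ≤ 4 * T * (C₆ * a) ^ 2 * (ρ t + e T ⬝ᵥ e T) := by positivity
          linarith
      _ ≤ C * (ρ t + (e T ⬝ᵥ e T + I)) := by gcongr

end Paths

/-! ### Measurability of processes with continuous paths -/

section Measurability

theorem clamp_eq_self {T t : ℝ} (ht : t ∈ Icc 0 T) : max 0 (min t T) = t := by
  rw [min_eq_left ht.2, max_eq_right ht.1]

theorem ae_prod_mem_Icc {Ω : Type*} [MeasurableSpace Ω] {P : Measure Ω} {T : ℝ} :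
    ∀ᵐ q : Ω × ℝ ∂(P.prod (volume.restrict (Icc 0 T))), q.2 ∈ Icc 0 T :=
  Measure.quasiMeasurePreserving_snd.ae (ae_restrict_mem measurableSet_Icc)

variable {Ω E : Type*} [NormedAddCommGroup E] [MeasurableSpace E] [BorelSpace E] {T : ℝ}

/-- A process with continuous paths on `[0, T]`, stopped outside `[0, T]`, is jointly
measurable. -/
theorem measurable_uncurry_clamp {m : MeasurableSpace Ω} (hT : 0 ≤ T) {X : ℝ → Ω → E}
    (hc : ∀ ω, ContinuousOn (fun t => X t ω) (Icc 0 T)) (hm : ∀ t ∈ Icc 0 T, Measurable (X t)) :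
    Measurable (Function.uncurry fun t ω => X (max 0 (min t T)) ω) := by
  have hmem : ∀ t : ℝ, max 0 (min t T) ∈ Icc 0 T := fun t =>
    ⟨le_max_left _ _, max_le hT (min_le_right _ _)⟩
  exact measurable_uncurry_of_continuous_of_measurable
    (fun ω => (hc ω).comp_continuous (by fun_prop) hmem) fun t => hm _ (hmem t)

variable [SecondCountableTopology E]

theorem measurable_intervalIntegral_of_continuousOn {m : MeasurableSpace Ω} [NormedSpace ℝ E]
    (hT : 0 ≤ T) {X : ℝ → Ω → E} (hc : ∀ ω, ContinuousOn (fun t => X t ω) (Icc 0 T))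
    (hm : ∀ t ∈ Icc 0 T, Measurable (X t)) :
    Measurable fun ω => ∫ t in (0 : ℝ)..T, X t ω := by
  have h := (measurable_uncurry_clamp hT hc hm).comp (measurable_swap (α := Ω) (β := ℝ))
  have h2 := (h.stronglyMeasurable.integral_prod_right'
    (ν := volume.restrict (Ioc 0 T))).measurable
  convert h2 using 2 with ω
  rw [intervalIntegral.integral_of_le hT]
  refine setIntegral_congr_fun measurableSet_Ioc fun t ht => ?_
  simp only [Function.comp_apply, Prod.swap_prod_mk, Function.uncurry_apply_pair]
  rw [clamp_eq_self ⟨ht.1.le, ht.2⟩]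

variable [MeasurableSpace Ω] {P : Measure Ω}

theorem aestronglyMeasurable_prod_of_continuousOn (hT : 0 ≤ T) {X : ℝ → Ω → E}
    (hc : ∀ ω, ContinuousOn (fun t => X t ω) (Icc 0 T)) (hm : ∀ t ∈ Icc 0 T, Measurable (X t)) :
    AEStronglyMeasurable (fun q : Ω × ℝ => X q.2 q.1) (P.prod (volume.restrict (Icc 0 T))) := by
  have h := (measurable_uncurry_clamp hT hc hm).comp (measurable_swap (α := Ω) (β := ℝ))
  refine h.stronglyMeasurable.aestronglyMeasurable.congr ?_
  filter_upwards [ae_prod_mem_Icc (P := P) (T := T)] with q hq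
  simp only [Function.comp_apply, Prod.swap, Function.uncurry_apply_pair]
  rw [clamp_eq_self hq]

end Measurability

/-! ### Conditional expectation processes -/

section CondExp

variable {Ω : Type*} [m0 : MeasurableSpace Ω] {P : Measure Ω} [IsProbabilityMeasure P]
  {ℱ : ℝ → MeasurableSpace Ω} {T : ℝ}

/-- In the integral against an adapted process, a random vector may be replaced by the process of
its conditional expectations. Only the product itself has to be integrable. -/
theorem integrable_prod_condExpProcess {E F : Type*} [NormedAddCommGroup E] [NormedSpace ℝ E]
    [CompleteSpace E] [SecondCountableTopology E] [MeasurableSpace E] [BorelSpace E]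
    [NormedAddCommGroup F] [NormedSpace ℝ F] (L : F →L[ℝ] E →L[ℝ] ℝ)
    (hle : ∀ t ∈ Icc 0 T, ℱ t ≤ m0) {X : Ω → E} (hX : Integrable X P)
    {M : ℝ → Ω → E} (hM : IsCondExpProcess P ℱ T X M) {α : ℝ → Ω → F}
    (hα : ∀ t ∈ Icc 0 T, StronglyMeasurable[ℱ t] (α t))
    (hαm : AEStronglyMeasurable (fun q : Ω × ℝ => α q.2 q.1)
      (P.prod (volume.restrict (Icc 0 T))))
    (hint : Integrable (fun q : Ω × ℝ => L (α q.2 q.1) (X q.1))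
      (P.prod (volume.restrict (Icc 0 T)))) :
    Integrable (fun q : Ω × ℝ => L (α q.2 q.1) (M q.2 q.1))
        (P.prod (volume.restrict (Icc 0 T))) ∧
      ∫ q : Ω × ℝ, L (α q.2 q.1) (M q.2 q.1) ∂(P.prod (volume.restrict (Icc 0 T)))
        = ∫ q : Ω × ℝ, L (α q.2 q.1) (X q.1) ∂(P.prod (volume.restrict (Icc 0 T))) := by
  have hXm : AEStronglyMeasurable (fun q : Ω × ℝ => L (α q.2 q.1) (M q.2 q.1))
      (P.prod (volume.restrict (Icc 0 T))) :=
    L.aestronglyMeasurable_comp₂ hαm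
      (hM.measurable.comp measurable_swap).stronglyMeasurable.aestronglyMeasurable
  obtain ⟨h1, h2⟩ := (integrable_prod_iff' hint.aestronglyMeasurable).1 hint
  have key : ∀ᵐ t ∂(volume.restrict (Icc 0 T)), (fun ω => L (α t ω) (M t ω))
      =ᵐ[P] P[fun ω => L (α t ω) (X ω) | ℱ t] := by
    filter_upwards [h1, ae_restrict_mem measurableSet_Icc] with t ht htm
    filter_upwards [condExp_bilin_of_stronglyMeasurable_left L (hα t htm) ht hX,
      hM.eq_condExp t htm] with ω h3 h4
    rw [h3, h4]
  have hint2 : Integrable (fun q : Ω × ℝ => L (α q.2 q.1) (M q.2 q.1))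
      (P.prod (volume.restrict (Icc 0 T))) := by
    refine (integrable_prod_iff' hXm).2 ⟨?_, ?_⟩
    · filter_upwards [key] with t ht using integrable_condExp.congr ht.symm
    · refine h2.mono' hXm.norm.prod_swap.integral_prod_right' ?_
      filter_upwards [key] with t ht
      rw [Real.norm_of_nonneg (integral_nonneg fun _ => norm_nonneg _)]
      calc ∫ ω, ‖L (α t ω) (M t ω)‖ ∂P
          = ∫ ω, |(P[fun ω => L (α t ω) (X ω) | ℱ t]) ω| ∂P :=
            integral_congr_ae (ht.mono fun ω h => congrArg abs h)
        _ ≤ _ := integral_abs_condExp_le _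
  refine ⟨hint2, ?_⟩
  rw [integral_prod_symm _ hint2, integral_prod_symm _ hint]
  refine integral_congr_ae ?_
  filter_upwards [key, ae_restrict_mem measurableSet_Icc] with t ht htm
  rw [integral_congr_ae ht, integral_condExp (hle t htm)]

/-- A left-continuous filtration on `[0, T]` admits jointly measurable versions of the processes
of conditional expectations: by Lévy's upward theorem, `E[X | ℱ_t]` is the limit of the conditional
expectations at the dyadic approximations of `t` from below, and these are step functions of
`t`. -/
theorem exists_isCondExpProcess_real (hmono : Monotone ℱ) (hle : ∀ t, ℱ t ≤ m0)
    (hleft : ∀ t ∈ Icc 0 T, ∀ d : ℕ → ℝ, (∀ n, 0 ≤ d n) → (∀ n, d n ≤ t) →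
      Tendsto d atTop (𝓝 t) → ℱ t ≤ ⨆ n, ℱ (d n)) (X : Ω → ℝ) :
    ∃ M : ℝ → Ω → ℝ, IsCondExpProcess P ℱ T X M := by
  let d : ℕ → ℝ → ℝ := fun n t => (⌊(2 : ℝ) ^ n * t⌋₊ : ℝ) / 2 ^ n
  have hd0 : ∀ n t, 0 ≤ d n t := fun n t => by positivity
  have hdle : ∀ n t, 0 ≤ t → d n t ≤ t := fun n t ht => by
    rw [div_le_iff₀ (by positivity), mul_comm]
    exact Nat.floor_le (by positivity)
  have hdmono : ∀ t, 0 ≤ t → Monotone fun n => d n t := fun t ht => by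
    refine monotone_nat_of_le_succ fun n => ?_
    simp only [d]
    rw [div_le_div_iff₀ (by positivity) (by positivity), pow_succ]
    have h1 : 2 * ⌊(2 : ℝ) ^ n * t⌋₊ ≤ ⌊(2 : ℝ) ^ n * 2 * t⌋₊ := by
      refine Nat.le_floor ?_
      push_cast
      have := Nat.floor_le (a := (2 : ℝ) ^ n * t) (by positivity)
      linarith
    have h2 : (2 : ℝ) * ⌊(2 : ℝ) ^ n * t⌋₊ ≤ ⌊(2 : ℝ) ^ n * 2 * t⌋₊ := by exact_mod_cast h1
    have h3 : (0 : ℝ) < 2 ^ n := by positivity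
    nlinarith
  have hdlim : ∀ t, 0 ≤ t → Tendsto (fun n => d n t) atTop (𝓝 t) := fun t ht => by
    have := (tendsto_nat_floor_mul_div_atTop (R := ℝ) ht).comp
      (tendsto_pow_atTop_atTop_of_one_lt (one_lt_two (α := ℝ)))
    refine this.congr fun n => ?_
    simp [d, mul_comm]
  -- at level `n` only countably many conditional expectations occur
  have hmeas : ∀ n, Measurable
      (fun q : ℝ × Ω => (P[X | ℱ ((⌊(2 : ℝ) ^ n * q.1⌋₊ : ℝ) / 2 ^ n)]) q.2) := fun n => by
    have h1 : Measurable fun q : ℕ × Ω => (P[X | ℱ ((q.1 : ℝ) / 2 ^ n)]) q.2 :=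
      measurable_from_prod_countable_right fun k =>
        (stronglyMeasurable_condExp.mono (hle ((k : ℝ) / 2 ^ n))).measurable
    exact h1.comp (((measurable_const.mul measurable_fst).nat_floor).prodMk measurable_snd)
  refine ⟨fun t ω => limUnder atTop fun n => (P[X | ℱ (d n t)]) ω, ?_, fun t ht => ?_⟩
  · exact (StronglyMeasurable.limUnder fun n => (hmeas n).stronglyMeasurable).measurable
  · let 𝒢 : Filtration ℕ m0 :=
      { seq := fun n => ℱ (d n t)
        mono' := fun a b hab => hmono (hdmono t ht.1 hab)
        le' := fun n => hle _ }
    have hsup : ⨆ n, 𝒢 n = ℱ t :=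
      le_antisymm (iSup_le fun n => hmono (hdle n t ht.1))
        (hleft t ht (fun n => d n t) (fun n => hd0 n t) (fun n => hdle n t ht.1) (hdlim t ht.1))
    have := tendsto_ae_condExp (μ := P) (ℱ := 𝒢) X
    rw [hsup] at this
    filter_upwards [this] with ω hω using hω.limUnder_eq

theorem exists_isCondExpProcess_pi {ι : Type*} [Fintype ι] (hmono : Monotone ℱ)
    (hle : ∀ t, ℱ t ≤ m0)
    (hleft : ∀ t ∈ Icc 0 T, ∀ d : ℕ → ℝ, (∀ n, 0 ≤ d n) → (∀ n, d n ≤ t) →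
      Tendsto d atTop (𝓝 t) → ℱ t ≤ ⨆ n, ℱ (d n)) {X : Ω → ι → ℝ} (hX : Integrable X P) :
    ∃ M : ℝ → Ω → ι → ℝ, IsCondExpProcess P ℱ T X M := by
  choose M hM using fun j => exists_isCondExpProcess_real (P := P) hmono hle hleft fun ω => X ω j
  refine ⟨fun t ω j => M j t ω, measurable_pi_lambda _ fun j => (hM j).measurable,
    fun t ht => ?_⟩
  have h : ∀ j, ∀ᵐ ω ∂P, M j t ω = (P[X | ℱ t]) ω j := fun j => by
    filter_upwards [(hM j).eq_condExp t ht,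
      (ContinuousLinearMap.proj (R := ℝ) (φ := fun _ : ι => ℝ) j).comp_condExp_comm (m := ℱ t) hX]
      with ω h1 h2
    rw [h1]
    exact h2.symm
  filter_upwards [ae_all_iff.2 h] with ω hω
  exact funext hω

end CondExp

/-! ### Exponential moments of a quadratic perturbation -/

section Exponential

theorem exp_add_mul_sub_exp_le {G a b s : ℝ} (hb : 0 ≤ b) (hs0 : 0 ≤ s) (hs1 : s ≤ 1) :
    Real.exp (G + s * a + s ^ 2 * b) - Real.exp G ≤ s * Real.exp (G + a + b) := by
  have h1 : Real.exp (G + s * a + s ^ 2 * b) ≤ Real.exp ((1 - s) * G + s * (G + a + b)) := by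
    refine Real.exp_le_exp.2 ?_
    nlinarith [mul_nonneg (mul_nonneg hs0 (sub_nonneg.2 hs1)) hb]
  have h2 := convexOn_exp.2 (mem_univ G) (mem_univ (G + a + b)) (sub_nonneg.2 hs1) hs0
    (sub_add_cancel 1 s)
  simp only [smul_eq_mul] at h2
  nlinarith [mul_nonneg hs0 (Real.exp_pos G).le]

theorem two_mul_exp_le (x a : ℝ) : 2 * Real.exp x ≤ Real.exp (x + a) + Real.exp (x - a) := by
  have h := convexOn_exp.2 (mem_univ (x + a)) (mem_univ (x - a)) (by norm_num : (0 : ℝ) ≤ 1 / 2)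
    (by norm_num : (0 : ℝ) ≤ 1 / 2) (by norm_num)
  simp only [smul_eq_mul] at h
  rw [show 1 / 2 * (x + a) + 1 / 2 * (x - a) = x by ring] at h
  linarith

/-- The difference quotients at `0` of the convex function `ε ↦ exp (G + ε a + ε² b)` are bounded
uniformly for `|ε| ≤ δ`. -/
theorem abs_exp_sub_exp_le {G a b δ ε : ℝ} (hb : 0 ≤ b) (hδ : 0 < δ) (hε : |ε| ≤ δ) :
    |Real.exp (G + ε * a + ε ^ 2 * b) - Real.exp G| ≤
      |ε| * (δ⁻¹ * (Real.exp (G + δ * a + δ ^ 2 * b) + Real.exp (G - δ * a + δ ^ 2 * b))) := by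
  wlog h0 : 0 ≤ ε generalizing ε a
  · have := this (a := -a) (ε := -ε) (by rwa [abs_neg]) (by linarith)
    rw [abs_neg] at this
    convert this using 2
    · congr 3 <;> ring
    · rw [add_comm]; congr 3 <;> ring
  rw [abs_of_nonneg h0] at hε ⊢
  have hs0 : 0 ≤ ε / δ := by positivity
  have hs1 : ε / δ ≤ 1 := (div_le_one hδ).2 hε
  have e1 : ∀ c : ℝ, ε / δ * (δ * c) = ε * c := fun c => by field_simp
  have e2 : (ε / δ) ^ 2 * (δ ^ 2 * b) = ε ^ 2 * b := by field_simp
  have hb' : 0 ≤ δ ^ 2 * b := by positivity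
  have h1 := exp_add_mul_sub_exp_le (G := G) (a := δ * a) hb' hs0 hs1
  have h2 := exp_add_mul_sub_exp_le (G := G) (a := δ * -a) hb' hs0 hs1
  rw [e1, e2] at h1 h2
  rw [show G + δ * -a + δ ^ 2 * b = G - δ * a + δ ^ 2 * b by ring] at h2
  have h3 : 2 * Real.exp G ≤ Real.exp (G + ε * a + ε ^ 2 * b)
      + Real.exp (G + ε * -a + ε ^ 2 * b) := by
    have := two_mul_exp_le (G + ε ^ 2 * b) (ε * a)
    have h4 : Real.exp G ≤ Real.exp (G + ε ^ 2 * b) :=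
      Real.exp_le_exp.2 (le_add_of_nonneg_right (by positivity))
    rw [show G + ε ^ 2 * b + ε * a = G + ε * a + ε ^ 2 * b by ring,
      show G + ε ^ 2 * b - ε * a = G + ε * -a + ε ^ 2 * b by ring] at this
    linarith
  have p1 : 0 ≤ ε / δ * Real.exp (G + δ * a + δ ^ 2 * b) := by positivity
  have p2 : 0 ≤ ε / δ * Real.exp (G - δ * a + δ ^ 2 * b) := by positivity
  have e3 : ε * (δ⁻¹ * (Real.exp (G + δ * a + δ ^ 2 * b) + Real.exp (G - δ * a + δ ^ 2 * b)))
      = ε / δ * Real.exp (G + δ * a + δ ^ 2 * b) + ε / δ * Real.exp (G - δ * a + δ ^ 2 * b) := by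
    ring
  rw [e3, abs_le]
  constructor <;> linarith

variable {Ω : Type*} [MeasurableSpace Ω] {P : Measure Ω} {G a b : Ω → ℝ} {δ : ℝ}

theorem integrable_exp_mul_quadratic (hb : ∀ᵐ ω ∂P, 0 ≤ b ω) (hδ : 0 < δ)
    (hm : AEStronglyMeasurable (fun ω => Real.exp (G ω) * b ω) P)
    (hint : ∀ ε, |ε| ≤ δ → Integrable (fun ω => Real.exp (G ω + ε * a ω + ε ^ 2 * b ω)) P) :
    Integrable (fun ω => Real.exp (G ω) * b ω) P := by
  have hp := hint δ (abs_of_pos hδ).le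
  have hn := hint (-δ) (by rw [abs_neg, abs_of_pos hδ])
  refine ((hp.add hn).const_mul (δ ^ 2)⁻¹).mono' hm ?_
  filter_upwards [hb] with ω hω
  rw [Real.norm_of_nonneg (by positivity)]
  have h1 := two_mul_exp_le (G ω + δ ^ 2 * b ω) (δ * a ω)
  have h2 : δ ^ 2 * b ω ≤ Real.exp (δ ^ 2 * b ω) := by
    linarith [Real.add_one_le_exp (δ ^ 2 * b ω)]
  have h3 : Real.exp (G ω) * (δ ^ 2 * b ω) ≤ Real.exp (G ω + δ ^ 2 * b ω) := by
    rw [Real.exp_add]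
    exact mul_le_mul_of_nonneg_left h2 (Real.exp_pos _).le
  have h4 : 0 < Real.exp (G ω + δ ^ 2 * b ω) := Real.exp_pos _
  rw [le_inv_mul_iff₀ (by positivity)]
  simp only [Pi.add_apply]
  rw [show G ω + δ * a ω + δ ^ 2 * b ω = G ω + δ ^ 2 * b ω + δ * a ω by ring,
    show G ω + -δ * a ω + (-δ) ^ 2 * b ω = G ω + δ ^ 2 * b ω - δ * a ω by ring]
  linarith

/-- Differentiation under the expectation, by domination of the difference quotients. -/
theorem hasDerivAt_integral_exp_quadratic (hb : ∀ᵐ ω ∂P, 0 ≤ b ω) (hδ : 0 < δ)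
    (hint : ∀ ε, |ε| ≤ δ → Integrable (fun ω => Real.exp (G ω + ε * a ω + ε ^ 2 * b ω)) P) :
    HasDerivAt (fun ε : ℝ => ∫ ω, Real.exp (G ω + ε * a ω + ε ^ 2 * b ω) ∂P)
      (∫ ω, Real.exp (G ω) * a ω ∂P) 0 := by
  have hG : Integrable (fun ω => Real.exp (G ω)) P := by
    simpa using hint 0 (by simpa using hδ.le)
  have hp := hint δ (abs_of_pos hδ).le
  have hn : Integrable (fun ω => Real.exp (G ω - δ * a ω + δ ^ 2 * b ω)) P := by
    refine (hint (-δ) (by rw [abs_neg, abs_of_pos hδ])).congr (ae_of_all _ fun ω => ?_)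
    simp only [neg_sq, neg_mul, sub_eq_add_neg]
  rw [hasDerivAt_iff_tendsto_slope_zero]
  have hev : ∀ᶠ ε : ℝ in 𝓝[≠] 0, |ε| ≤ δ ∧ ε ≠ 0 := by
    refine (eventually_nhdsWithin_of_eventually_nhds ?_).and self_mem_nhdsWithin
    filter_upwards [Metric.closedBall_mem_nhds (0 : ℝ) hδ] with ε hε
    simpa using hε
  have hlim := tendsto_integral_filter_of_dominated_convergence (μ := P) (l := 𝓝[≠] (0 : ℝ))
    (F := fun ε ω => ε⁻¹ * (Real.exp (G ω + ε * a ω + ε ^ 2 * b ω) - Real.exp (G ω)))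
    (f := fun ω => Real.exp (G ω) * a ω)
    (fun ω => δ⁻¹ * (Real.exp (G ω + δ * a ω + δ ^ 2 * b ω)
      + Real.exp (G ω - δ * a ω + δ ^ 2 * b ω)))
    (hev.mono fun ε hε => (((hint ε hε.1).sub hG).const_mul _).aestronglyMeasurable)
    (hev.mono fun ε hε => by
      filter_upwards [hb] with ω hω
      rw [norm_mul, norm_inv, Real.norm_eq_abs, Real.norm_eq_abs,
        inv_mul_le_iff₀ (abs_pos.2 hε.2)]
      exact abs_exp_sub_exp_le hω hδ hε.1)
    ((hp.add hn).const_mul _)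
    (ae_of_all _ fun ω => by
      have h1 : HasDerivAt (fun ε : ℝ => G ω + ε * a ω + ε ^ 2 * b ω) (a ω) 0 := by
        have := (((hasDerivAt_id (0 : ℝ)).mul_const (a ω)).const_add (G ω)).add
          ((hasDerivAt_pow 2 (0 : ℝ)).mul_const (b ω))
        simpa [Pi.add_def] using this
      have h2 := hasDerivAt_iff_tendsto_slope_zero.1 h1.exp
      simpa using h2)
  refine hlim.congr' (hev.mono fun ε hε => ?_)
  rw [integral_const_mul, integral_sub (hint ε hε.1) hG]
  simp

end Exponential

/-! ### Continuous adapted processes -/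

/-- `X` has continuous paths on `[0, T]` and is adapted to `ℱ` there. No condition is imposed
outside `[0, T]`. -/
structure ContAdapted {Ω E : Type*} [TopologicalSpace E] [MeasurableSpace E]
    (ℱ : ℝ → MeasurableSpace Ω) (T : ℝ) (X : ℝ → Ω → E) : Prop where
  adapted : ∀ t ∈ Icc 0 T, Measurable[ℱ t] (X t)
  continuous : ∀ ω, ContinuousOn (fun t => X t ω) (Icc 0 T)

namespace ContAdapted

variable {Ω ι κ : Type*} [Fintype ι] [Fintype κ] {ℱ : ℝ → MeasurableSpace Ω} {T : ℝ}

theorem mono {E : Type*} [TopologicalSpace E] [MeasurableSpace E] {ℱ' : ℝ → MeasurableSpace Ω}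
    {X : ℝ → Ω → E} (hX : ContAdapted ℱ T X) (h : ∀ t ∈ Icc 0 T, ℱ t ≤ ℱ' t) :
    ContAdapted ℱ' T X :=
  ⟨fun t ht => (hX.adapted t ht).mono (h t ht) le_rfl, hX.continuous⟩

theorem comp_continuous₂ {E F G : Type*} [TopologicalSpace E] [SecondCountableTopology E]
    [MeasurableSpace E] [BorelSpace E] [TopologicalSpace F] [SecondCountableTopology F]
    [MeasurableSpace F] [BorelSpace F] [TopologicalSpace G] [MeasurableSpace G] [BorelSpace G]
    {X : ℝ → Ω → E} {Y : ℝ → Ω → F} (hX : ContAdapted ℱ T X) (hY : ContAdapted ℱ T Y)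
    {φ : ℝ → E × F → G} (hφ : Continuous fun q : ℝ × (E × F) => φ q.1 q.2) :
    ContAdapted ℱ T fun t ω => φ t (X t ω, Y t ω) where
  adapted t ht := (hφ.comp (continuous_const.prodMk continuous_id)).measurable.comp
    ((hX.adapted t ht).prodMk (hY.adapted t ht))
  continuous ω := hφ.comp_continuousOn
    (continuousOn_id.prodMk ((hX.continuous ω).prodMk (hY.continuous ω)))

theorem add {X Y : ℝ → Ω → ι → ℝ} (hX : ContAdapted ℱ T X) (hY : ContAdapted ℱ T Y) :
    ContAdapted ℱ T fun t ω => X t ω + Y t ω :=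
  hX.comp_continuous₂ hY (φ := fun _ q => q.1 + q.2) (by fun_prop)

theorem sub {X Y : ℝ → Ω → ι → ℝ} (hX : ContAdapted ℱ T X) (hY : ContAdapted ℱ T Y) :
    ContAdapted ℱ T fun t ω => X t ω - Y t ω :=
  hX.comp_continuous₂ hY (φ := fun _ q => q.1 - q.2) (by fun_prop)

theorem dotProduct {X Y : ℝ → Ω → ι → ℝ} (hX : ContAdapted ℱ T X) (hY : ContAdapted ℱ T Y) :
    ContAdapted ℱ T fun t ω => X t ω ⬝ᵥ Y t ω :=
  hX.comp_continuous₂ hY (φ := fun _ q => q.1 ⬝ᵥ q.2) (by fun_prop)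

theorem mulVec {M : ℝ → Matrix ι κ ℝ} (hM : Continuous M) {X : ℝ → Ω → κ → ℝ}
    (hX : ContAdapted ℱ T X) : ContAdapted ℱ T fun t ω => M t *ᵥ X t ω :=
  hX.comp_continuous₂ hX (φ := fun t q => M t *ᵥ q.1) (by fun_prop)

theorem const_mulVec (M : Matrix ι κ ℝ) {X : ℝ → Ω → κ → ℝ} (hX : ContAdapted ℱ T X) :
    ContAdapted ℱ T fun t ω => M *ᵥ X t ω :=
  hX.mulVec (M := fun _ => M) continuous_const

theorem sub_const {X : ℝ → Ω → ι → ℝ} (hX : ContAdapted ℱ T X) (c : ι → ℝ) :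
    ContAdapted ℱ T fun t ω => X t ω - c :=
  hX.comp_continuous₂ hX (φ := fun _ q => q.1 - c) (by fun_prop)

theorem sq_norm {X : ℝ → Ω → ι → ℝ} (hX : ContAdapted ℱ T X) :
    ContAdapted ℱ T fun t ω => ‖X t ω‖ ^ 2 :=
  hX.comp_continuous₂ hX (φ := fun _ q => ‖q.1‖ ^ 2) (by fun_prop)

theorem primitive (hℱ : Monotone ℱ) {X : ℝ → Ω → ι → ℝ} (hX : ContAdapted ℱ T X) :
    ContAdapted ℱ T fun t ω => ∫ s in (0 : ℝ)..t, X s ω where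
  adapted t ht := measurable_intervalIntegral_of_continuousOn (m := ℱ t) ht.1
    (fun ω => (hX.continuous ω).mono (Icc_subset_Icc_right ht.2))
    fun s hs => (hX.adapted s ⟨hs.1, hs.2.trans ht.2⟩).mono (hℱ hs.2) le_rfl
  continuous ω := by
    rcases lt_or_ge T 0 with h | h
    · simp [Icc_eq_empty_of_lt h]
    · exact continuousOn_primitive h (hX.continuous ω)

theorem runQuad {Q : Matrix ι ι ℝ} {S : Matrix ι κ ℝ} {R : Matrix κ κ ℝ} {X : ℝ → Ω → ι → ℝ}
    {U : ℝ → Ω → κ → ℝ} (hX : ContAdapted ℱ T X) (hU : ContAdapted ℱ T U) :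
    ContAdapted ℱ T fun t ω => runQuad Q S R (X t ω) (U t ω) :=
  hX.comp_continuous₂ hU (φ := fun _ q => RiskMFG.runQuad Q S R q.1 q.2)
    (by unfold RiskMFG.runQuad; fun_prop)

variable [m0 : MeasurableSpace Ω]

theorem measurable_integral {E : Type*} [NormedAddCommGroup E] [NormedSpace ℝ E]
    [SecondCountableTopology E] [MeasurableSpace E] [BorelSpace E] (hT : 0 ≤ T)
    (hle : ∀ t ∈ Icc 0 T, ℱ t ≤ m0) {X : ℝ → Ω → E} (hX : ContAdapted ℱ T X) :
    Measurable fun ω => ∫ t in (0 : ℝ)..T, X t ω :=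
  measurable_intervalIntegral_of_continuousOn hT hX.continuous
    fun t ht => (hX.adapted t ht).mono (hle t ht) le_rfl

theorem aestronglyMeasurable {E : Type*} [NormedAddCommGroup E] [SecondCountableTopology E]
    [MeasurableSpace E] [BorelSpace E] {P : Measure Ω} (hT : 0 ≤ T)
    (hle : ∀ t ∈ Icc 0 T, ℱ t ≤ m0) {X : ℝ → Ω → E} (hX : ContAdapted ℱ T X) :
    AEStronglyMeasurable (fun q : Ω × ℝ => X q.2 q.1) (P.prod (volume.restrict (Icc 0 T))) :=
  aestronglyMeasurable_prod_of_continuousOn hT hX.continuous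
    fun t ht => (hX.adapted t ht).mono (hle t ht) le_rfl

theorem measurable_quadCost (hT : 0 ≤ T) (hle : ∀ t ∈ Icc 0 T, ℱ t ≤ m0)
    (Qhat Q : Matrix ι ι ℝ) (S : Matrix ι κ ℝ) (R : Matrix κ κ ℝ) {X : ℝ → Ω → ι → ℝ}
    {U : ℝ → Ω → κ → ℝ} (hX : ContAdapted ℱ T X) (hU : ContAdapted ℱ T U) :
    Measurable fun ω => quadCost T Qhat Q S R (fun t => X t ω) fun t => U t ω := by
  have hTm : T ∈ Icc 0 T := ⟨hT, le_rfl⟩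
  have h1 := ((hX.dotProduct (hX.const_mulVec Qhat)).adapted T hTm).mono (hle T hTm) le_rfl
  have h2 := (hX.runQuad (Q := Q) (S := S) (R := R) hU).measurable_integral hT hle
  unfold quadCost
  simp only [intervalIntegral.integral_const_mul]
  exact (h1.const_mul _).add (h2.const_mul _)

/-- Tonelli for a nonnegative process with continuous paths and a nonnegative weight. -/
theorem integrable_prod_mul {P : Measure Ω} [SFinite P] (hT : 0 ≤ T)
    (hle : ∀ t ∈ Icc 0 T, ℱ t ≤ m0) {W : Ω → ℝ} (hWm : Measurable W) (hW : ∀ ω, 0 ≤ W ω)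
    {ρ : ℝ → Ω → ℝ} (hρ : ContAdapted ℱ T ρ) (hρ0 : ∀ t ω, 0 ≤ ρ t ω)
    (hint : Integrable (fun ω => W ω * ∫ t in (0 : ℝ)..T, ρ t ω) P) :
    Integrable (fun q : Ω × ℝ => W q.1 * ρ q.2 q.1) (P.prod (volume.restrict (Icc 0 T))) := by
  have hm : AEStronglyMeasurable (fun q : Ω × ℝ => W q.1 * ρ q.2 q.1)
      (P.prod (volume.restrict (Icc 0 T))) :=
    (hWm.comp measurable_fst).aestronglyMeasurable.mul (hρ.aestronglyMeasurable hT hle)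
  refine (integrable_prod_iff hm).2 ⟨ae_of_all _ fun ω => ?_, ?_⟩
  · exact ((hρ.continuous ω).integrableOn_Icc).const_mul (W ω)
  · refine hint.congr (ae_of_all _ fun ω => ?_)
    simp only [norm_mul, Real.norm_of_nonneg (hW ω), Real.norm_of_nonneg (hρ0 _ ω)]
    rw [integral_const_mul, intervalIntegral.integral_of_le hT, integral_Icc_eq_integral_Ioc]

end ContAdapted

/-! ### The filtrations of the agents -/

namespace Agents

variable {K n m r : ℕ} {D : Model K n m r} {Ω : Type*} [m0 : MeasurableSpace Ω] {P : Measure Ω}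
  (a : Agents D P)

theorem noiseSigma_le (j : Option ℕ) (t : ℝ) : a.noiseSigma j t ≤ m0 :=
  iSup₂_le fun s _ => (a.w_measurable j s).comap_le

theorem noiseSigma_mono (j : Option ℕ) : Monotone (a.noiseSigma j) := fun _ _ hst =>
  iSup₂_le fun u hu => le_iSup₂_of_le (f := fun (s : ℝ≥0) (_ : s ∈ {s : ℝ≥0 | (s : ℝ) ≤ _}) =>
    MeasurableSpace.comap (a.w j s) inferInstance) u (le_trans hu hst) le_rfl

theorem filtration_le (i : ℕ) (t : ℝ) : a.filtration i t ≤ m0 :=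
  sup_le (sup_le (a.x₀_measurable i).comap_le (a.noiseSigma_le none t))
    (a.noiseSigma_le (some i) t)

theorem filtration_mono (i : ℕ) : Monotone (a.filtration i) := fun _ _ hst =>
  sup_le_sup (sup_le_sup_left (a.noiseSigma_mono none hst) _) (a.noiseSigma_mono (some i) hst)

theorem commonFiltration_le_filtration (i : ℕ) (t : ℝ) :
    a.commonFiltration t ≤ a.filtration i t :=
  le_sup_right.trans le_sup_left

/-- Left-continuity: `w_s` is the limit of `w_{min s d_n}` when `d_n → t ≥ s`. -/
theorem noiseSigma_le_iSup (j : Option ℕ) {t : ℝ} {d : ℕ → ℝ} (hd0 : ∀ n, 0 ≤ d n)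
    (hd : Tendsto d atTop (𝓝 t)) : a.noiseSigma j t ≤ ⨆ n, a.noiseSigma j (d n) := by
  refine iSup₂_le fun s hs => ?_
  rw [← measurable_iff_comap_le]
  have hs' : (s : ℝ) ≤ t := hs
  have hlim : Tendsto (fun n => min s (d n).toNNReal) atTop (𝓝 s) := by
    have h1 : Tendsto (fun n => min s (d n).toNNReal) atTop (𝓝 (min s t.toNNReal)) :=
      tendsto_const_nhds.min ((continuous_real_toNNReal.tendsto t).comp hd)
    rwa [min_eq_left (NNReal.le_toNNReal_of_coe_le hs')] at h1
  refine @measurable_of_tendsto_metrizable _ _ (⨆ n, a.noiseSigma j (d n)) _ _ _ _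
    (fun n => a.w j (min s (d n).toNNReal)) _ (fun n => ?_)
    (tendsto_pi_nhds.2 fun ω => ((a.w_continuous j ω).tendsto s).comp hlim)
  refine Measurable.mono (ma := a.noiseSigma j (d n)) (Measurable.of_comap_le ?_)
    (le_iSup (fun n => a.noiseSigma j (d n)) n) le_rfl
  refine le_iSup₂_of_le (f := fun (s : ℝ≥0) (_ : s ∈ {s : ℝ≥0 | (s : ℝ) ≤ d n}) =>
    MeasurableSpace.comap (a.w j s) inferInstance) (min s (d n).toNNReal) ?_ le_rfl
  have : ((min s (d n).toNNReal : ℝ≥0) : ℝ) ≤ ((d n).toNNReal : ℝ) :=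
    NNReal.coe_le_coe.2 (min_le_right _ _)
  rwa [Real.coe_toNNReal _ (hd0 n)] at this

theorem filtration_le_iSup (i : ℕ) {t : ℝ} {d : ℕ → ℝ} (hd0 : ∀ n, 0 ≤ d n)
    (hd : Tendsto d atTop (𝓝 t)) : a.filtration i t ≤ ⨆ n, a.filtration i (d n) := by
  refine sup_le (sup_le ?_ ?_) ?_
  · exact le_iSup_of_le 0 (le_sup_left.trans le_sup_left)
  · exact (a.noiseSigma_le_iSup none hd0 hd).trans
      (iSup_mono fun n => le_sup_right.trans le_sup_left)
  · exact (a.noiseSigma_le_iSup (some i) hd0 hd).trans (iSup_mono fun n => le_sup_right)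

/-! ### A single agent does not move the mean field -/

theorem tendsto_card_type_inv (l : Fin K) : Tendsto
    (fun N : ℕ => (((Finset.range N).filter fun j => a.type j = l).card : ℝ)⁻¹) atTop (𝓝 0) := by
  refine tendsto_inv_atTop_zero.comp (tendsto_natCast_atTop_atTop.comp ?_)
  refine tendsto_atTop_atTop_of_monotone
    (fun M N h => Finset.card_le_card (Finset.filter_subset_filter _ (Finset.range_mono h)))
    fun b => ?_
  obtain ⟨s, hs, hcard⟩ := (a.type_infinite l).exists_subset_card_eq b
  refine ⟨s.sup id + 1, hcard ▸ Finset.card_le_card fun j hj => ?_⟩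
  exact Finset.mem_filter.2 ⟨Finset.mem_range.2 (Nat.lt_succ_of_le (Finset.le_sup (f := id) hj)),
    hs hj⟩

theorem empiricalMean_update_sub (x : ℕ → ℝ → Ω → Fin n → ℝ) (i : ℕ) (y : ℝ → Ω → Fin n → ℝ)
    (l : Fin K) (N : ℕ) (t : ℝ) (ω : Ω) :
    a.empiricalMean (Function.update x i y) l N t ω - a.empiricalMean x l N t ω
      = (((Finset.range N).filter fun j => a.type j = l).card : ℝ)⁻¹ •
        if i ∈ (Finset.range N).filter (fun j => a.type j = l) then y t ω - x i t ω else 0 := by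
  rw [empiricalMean, empiricalMean, ← smul_sub, ← Finset.sum_sub_distrib]
  congr 1
  rw [← Finset.sum_ite_eq' ((Finset.range N).filter fun j => a.type j = l) i
    (fun _ => y t ω - x i t ω)]
  refine Finset.sum_congr rfl fun j _ => ?_
  rcases eq_or_ne j i with rfl | h
  · simp
  · simp [h]

/-- Each type has infinitely many agents, so a change of the state of one of them leaves the limits
of the empirical averages unchanged; continuity of the paths makes the exceptional null set
independent of the time. -/
theorem IsMeanField.ae_eq_of_update {a : Agents D P} {x : ℕ → ℝ → Ω → Fin n → ℝ}
    {xb yb : ℝ → Ω → Fin K × Fin n → ℝ} (hx : a.IsMeanField x xb) {i : ℕ}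
    {y : ℝ → Ω → Fin n → ℝ} (hy : a.IsMeanField (Function.update x i y) yb) :
    ∀ᵐ ω ∂P, ∀ t ∈ Icc 0 D.T, yb t ω = xb t ω := by
  have h1 : ∀ t ∈ Icc 0 D.T, ∀ᵐ ω ∂P, yb t ω = xb t ω := by
    intro t ht
    filter_upwards [ae_all_iff.2 fun l => hx.limit t ht l, ae_all_iff.2 fun l => hy.limit t ht l]
      with ω h1 h2
    funext p
    obtain ⟨l, c⟩ := p
    have h3 : Tendsto (fun N => a.empiricalMean (Function.update x i y) l N t ω
        - a.empiricalMean x l N t ω) atTop (𝓝 0) := by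
      have hz : Tendsto (fun N : ℕ =>
          (((Finset.range N).filter fun j => a.type j = l).card : ℝ)⁻¹ * ‖y t ω - x i t ω‖)
          atTop (𝓝 0) := by
        simpa using (a.tendsto_card_type_inv l).mul_const ‖y t ω - x i t ω‖
      refine squeeze_zero_norm (fun N => ?_) hz
      rw [empiricalMean_update_sub, norm_smul, norm_inv, Real.norm_natCast]
      refine mul_le_mul_of_nonneg_left ?_ (by positivity)
      split_ifs
      · exact le_rfl
      · simp
    have h4 := tendsto_nhds_unique h3 ((h2 l).sub (h1 l))
    have h5 := congrFun h4 c
    simp only [Pi.zero_apply, Pi.sub_apply] at h5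
    linarith
  obtain ⟨s, hs, hsd⟩ := TopologicalSpace.exists_countable_dense (Icc (0 : ℝ) D.T)
  filter_upwards [(ae_ball_iff hs).2 fun t _ => h1 t.1 t.2] with ω hω t ht
  have e := Continuous.ext_on hsd
    (continuousOn_iff_continuous_domRestrict.1 (hy.continuous ω))
    (continuousOn_iff_continuous_domRestrict.1 (hx.continuous ω)) fun u hu => hω u hu
  exact congrFun e ⟨t, ht⟩

end Agents

/-! ### Deviations of one agent -/

namespace Model

variable {K n m r : ℕ} (D : Model K n m r) (k : Fin K) {Ω : Type*}

/-- The change of the state of an agent of type `k` per unit change of its control in the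
direction `v`, that is, the solution of `z' = A z + B v`, `z(0) = 0`. -/
noncomputable def response (v : ℝ → Ω → Fin m → ℝ) (t : ℝ) (ω : Ω) : Fin n → ℝ :=
  NormedSpace.exp (t • D.A k) *ᵥ
    ∫ s in (0 : ℝ)..t, NormedSpace.exp (-s • D.A k) *ᵥ (D.B k *ᵥ v s ω)

theorem G_eq_quadCost (x : ℝ → Ω → Fin n → ℝ) (xb : ℝ → Ω → Fin K × Fin n → ℝ)
    (u : ℝ → Ω → Fin m → ℝ) (ω : Ω) :
    D.G k x xb u ω = (1 / D.γ k) * quadCost D.T (D.Qhat k) (D.Q k) (D.S k) (D.R k)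
      (fun t => D.err k (x t ω) (xb t ω)) fun t => u t ω := rfl

theorem weightedAdjoint_eq (x : ℝ → Ω → Fin n → ℝ) (xb : ℝ → Ω → Fin K × Fin n → ℝ)
    (u : ℝ → Ω → Fin m → ℝ) :
    D.weightedAdjoint k x xb u = fun ω => Real.exp (D.G k x xb u ω) •
      adjointTerminal D.T (D.A k) (D.Qhat k) (D.Q k) (D.S k)
        (fun t => D.err k (x t ω) (xb t ω)) fun t => u t ω := rfl

theorem h_eq (x : ℝ → Ω → Fin n → ℝ) (xb : ℝ → Ω → Fin K × Fin n → ℝ)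
    (u : ℝ → Ω → Fin m → ℝ) (M₁ : ℝ → Ω → ℝ) (M₂ : ℝ → Ω → Fin n → ℝ) (t : ℝ) (ω : Ω) :
    D.h k x xb u M₁ M₂ t ω
      = M₁ t ω • adjointControl (D.A k) (D.B k) (D.Q k) (D.S k) (D.R k)
          (fun t => D.err k (x t ω) (xb t ω)) (fun t => u t ω) t
        + (D.B k)ᵀ *ᵥ (NormedSpace.exp (-t • (D.A k)ᵀ) *ᵥ M₂ t ω) := rfl

theorem intervalIntegrable_drift {x : ℝ → Fin n → ℝ} {xb : ℝ → Fin K × Fin n → ℝ}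
    {u : ℝ → Fin m → ℝ} (hx : ContinuousOn x (Icc 0 D.T)) (hxb : ContinuousOn xb (Icc 0 D.T))
    (hu : ContinuousOn u (Icc 0 D.T)) {t : ℝ} (ht : t ∈ Icc 0 D.T) :
    IntervalIntegrable (fun s => D.drift k s (x s) (xb s) (u s)) volume 0 t := by
  have h1 : ContinuousOn (fun s => D.A k *ᵥ x s + D.blockRow (D.F k) *ᵥ xb s + D.B k *ᵥ u s)
      (Icc 0 D.T) :=
    ((continuousOn_mulVec continuousOn_const hx).add
      (continuousOn_mulVec continuousOn_const hxb)).add (continuousOn_mulVec continuousOn_const hu)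
  refine (intervalIntegrable_of_continuousOn_Icc h1 ht).add
    ((D.b_integrable k).mono_set ?_)
  rw [uIcc_of_le ht.1, uIcc_of_le D.T_pos.le]
  exact Icc_subset_Icc_right ht.2

variable {D k}

theorem contAdapted_response {ℱ : ℝ → MeasurableSpace Ω} (hℱ : Monotone ℱ)
    {v : ℝ → Ω → Fin m → ℝ} (hv : ContAdapted ℱ D.T v) :
    ContAdapted ℱ D.T (D.response k v) :=
  (((hv.const_mulVec (D.B k)).mulVec ((continuous_exp_smul (D.A k)).comp
    continuous_neg)).primitive hℱ).mulVec (continuous_exp_smul (D.A k))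

theorem contAdapted_err {ℱ : ℝ → MeasurableSpace Ω} {x : ℝ → Ω → Fin n → ℝ}
    {xb : ℝ → Ω → Fin K × Fin n → ℝ} (hx : ContAdapted ℱ D.T x) (hxb : ContAdapted ℱ D.T xb) :
    ContAdapted ℱ D.T fun t ω => D.err k (x t ω) (xb t ω) :=
  (hx.sub (hxb.const_mulVec _)).sub_const _

end Model

namespace Population

variable {K n m r : ℕ} {D : Model K n m r} {Ω : Type*} [MeasurableSpace Ω] {P : Measure Ω}
  {p : Population D P} {i : ℕ} {v : ℝ → Ω → Fin m → ℝ} {ε : ℝ}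
  {y : ℝ → Ω → Fin n → ℝ} {yb : ℝ → Ω → Fin K × Fin n → ℝ}

/-- The mean field is unchanged, and the state is unique and affine in the control. -/
theorem IsDeviation.ae_eq (h : p.IsDeviation i (p.u i + ε • v) y yb) (hv : p.IsAdmissible i v) :
    ∀ᵐ ω ∂P, ∀ t ∈ Icc 0 D.T, yb t ω = p.xbar t ω ∧
      y t ω = p.x i t ω + ε • D.response (p.type i) v t ω := by
  filter_upwards [p.xbar_meanField.ae_eq_of_update h.meanField, h.state.equation,
    (p.x_state i).equation] with ω hb hy hx
  have cy := h.state.continuous ω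
  have cx := (p.x_state i).continuous ω
  have cu := (p.u_admissible i).continuous ω
  have cv := hv.continuous ω
  have cw : ContinuousOn (fun t => ε • D.B (p.type i) *ᵥ v t ω) (Icc 0 D.T) :=
    (continuousOn_mulVec continuousOn_const cv).const_smul ε
  -- the difference of the two state equations contains neither noise nor mean field
  have hd : ∀ t ∈ Icc 0 D.T, y t ω - p.x i t ω = ∫ s in (0 : ℝ)..t,
      (D.A (p.type i) *ᵥ (y s ω - p.x i s ω) + ε • D.B (p.type i) *ᵥ v s ω) := by
    intro t ht
    have i1 := D.intervalIntegrable_drift (p.type i) cy (h.meanField.continuous ω)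
      (u := fun s => (p.u i + ε • v) s ω) (cu.add (cv.const_smul ε)) ht
    have i2 := D.intervalIntegrable_drift (p.type i) cx (p.xbar_meanField.continuous ω) cu ht
    have e1 : y t ω - p.x i t ω
        = (∫ s in (0 : ℝ)..t,
            D.drift (p.type i) s (y s ω) (yb s ω) ((p.u i + ε • v) s ω))
          - ∫ s in (0 : ℝ)..t, D.drift (p.type i) s (p.x i s ω) (p.xbar s ω) (p.u i s ω) := by
      conv_lhs => rw [hy t ht, hx t ht]
      abel
    rw [e1, ← intervalIntegral.integral_sub i1 i2]
    refine intervalIntegral.integral_congr fun s hs => ?_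
    rw [uIcc_of_le ht.1] at hs
    simp only [Model.drift, hb s ⟨hs.1, hs.2.trans ht.2⟩, Pi.add_apply, Pi.smul_apply,
      Matrix.mulVec_add, Matrix.mulVec_sub, Matrix.mulVec_smul]
    abel
  intro t ht
  refine ⟨hb t ht, ?_⟩
  rw [← sub_eq_iff_eq_add', eq_exp_mulVec_integral (D.A (p.type i))
    (z := fun t => y t ω - p.x i t ω) (cy.sub cx) cw hd ht]
  simp only [Matrix.mulVec_smul, intervalIntegral.integral_smul]
  rfl

/-- Along the direction `v`, the exponent is a quadratic polynomial in the step. -/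
theorem IsDeviation.G_ae_eq (h : p.IsDeviation i (p.u i + ε • v) y yb)
    (hv : p.IsAdmissible i v) :
    ∀ᵐ ω ∂P, D.G (p.type i) y yb (p.u i + ε • v) ω
      = D.G (p.type i) (p.x i) p.xbar (p.u i) ω
        + ε * ((1 / D.γ (p.type i)) * quadCostDeriv D.T (D.Qhat (p.type i)) (D.Q (p.type i))
            (D.S (p.type i)) (D.R (p.type i))
            (fun t => D.err (p.type i) (p.x i t ω) (p.xbar t ω)) (fun t => p.u i t ω)
            (fun t => D.response (p.type i) v t ω) fun t => v t ω)
        + ε ^ 2 * ((1 / D.γ (p.type i)) * quadCost D.T (D.Qhat (p.type i)) (D.Q (p.type i))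
            (D.S (p.type i)) (D.R (p.type i))
            (fun t => D.response (p.type i) v t ω) fun t => v t ω) := by
  have hT := D.T_pos.le
  have cv : ContAdapted (p.filtration i) D.T v := ⟨hv.adapted, hv.continuous⟩
  filter_upwards [h.ae_eq hv] with ω hω
  set k := p.type i
  have cz := (Model.contAdapted_response (k := k) (p.filtration_mono i) cv).continuous ω
  have cxb := p.xbar_meanField.continuous ω
  have ce : ContinuousOn (fun t => D.err k (p.x i t ω) (p.xbar t ω)) (Icc 0 D.T) :=
    (((p.x_state i).continuous ω).sub (continuousOn_mulVec continuousOn_const cxb)).sub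
      continuousOn_const
  have key := quadCost_add_smul (D.S k) hT (D.Qhat_symm k) (D.Q_symm k) (D.R_symm k) ce cz
    ((p.u_admissible i).continuous ω) (hv.continuous ω) ε
  have herr : ∀ t ∈ Icc 0 D.T, D.err k (y t ω) (yb t ω)
      = D.err k (p.x i t ω) (p.xbar t ω) + ε • D.response k v t ω := fun t ht => by
    rw [(hω t ht).1, (hω t ht).2, Model.err, Model.err]
    abel
  have hcost : quadCost D.T (D.Qhat k) (D.Q k) (D.S k) (D.R k)
      (fun t => D.err k (y t ω) (yb t ω)) (fun t => (p.u i + ε • v) t ω)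
      = quadCost D.T (D.Qhat k) (D.Q k) (D.S k) (D.R k)
        (fun t => D.err k (p.x i t ω) (p.xbar t ω) + ε • D.response k v t ω)
        fun t => p.u i t ω + ε • v t ω := by
    rw [quadCost, quadCost, herr D.T ⟨hT, le_rfl⟩]
    congr 1
    refine intervalIntegral.integral_congr fun t ht => ?_
    rw [uIcc_of_le hT] at ht
    simp only [herr t ht, Pi.add_apply, Pi.smul_apply]
  rw [Model.G_eq_quadCost, Model.G_eq_quadCost, hcost, key]
  ring

/-- The cost does not depend on the version of the deviation chosen in its definition. -/
theorem J_eq_of_isDeviation {w : ℝ → Ω → Fin m → ℝ} {Γ : Ω → ℝ}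
    (hex : ∃ y yb, p.IsDeviation i w y yb)
    (hΓ : ∀ y yb, p.IsDeviation i w y yb → ∀ᵐ ω ∂P, D.G (p.type i) y yb w ω = Γ ω) :
    p.J i w = D.γ (p.type i) * Real.log (∫ ω, Real.exp (Γ ω) ∂P) := by
  obtain ⟨y, yb, h⟩ := hex
  have hq : ∃ q : (ℝ → Ω → Fin n → ℝ) × (ℝ → Ω → Fin K × Fin n → ℝ),
      p.IsDeviation i w q.1 q.2 := ⟨(y, yb), h⟩
  rw [J, dif_pos hq]
  congr 2
  refine integral_congr_ae ?_
  filter_upwards [hΓ _ _ hq.choose_spec] with ω hω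
  rw [hω]

end Population

/-! ### Duality under a random weight -/

section WeightedDuality

variable {ι κ Ω : Type*} [Fintype ι] [Fintype κ] [DecidableEq ι] {T : ℝ}
  {ℱ : ℝ → MeasurableSpace Ω}

theorem contAdapted_adjointControl (hℱ : Monotone ℱ) (A : Matrix ι ι ℝ)
    (B : Matrix ι κ ℝ) (Q : Matrix ι ι ℝ) (S : Matrix ι κ ℝ) (R : Matrix κ κ ℝ)
    {e : ℝ → Ω → ι → ℝ} {u : ℝ → Ω → κ → ℝ} (he : ContAdapted ℱ T e) (hu : ContAdapted ℱ T u) :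
    ContAdapted ℱ T fun t ω =>
      adjointControl A B Q S R (fun s => e s ω) (fun s => u s ω) t := by
  have hq := (he.const_mulVec Q).add (hu.const_mulVec S)
  have h := ((he.const_mulVec Sᵀ).add (hu.const_mulVec R)).sub
    ((((hq.mulVec (continuous_exp_smul Aᵀ)).primitive hℱ).mulVec
      ((continuous_exp_smul Aᵀ).comp continuous_neg)).const_mulVec Bᵀ)
  have e1 : ∀ t ∈ Icc 0 T, ∀ ω, adjointControl A B Q S R (fun s => e s ω) (fun s => u s ω) t
      = Sᵀ *ᵥ e t ω + R *ᵥ u t ω - Bᵀ *ᵥ (NormedSpace.exp (-t • Aᵀ) *ᵥ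
        ∫ s in (0 : ℝ)..t, NormedSpace.exp (s • Aᵀ) *ᵥ (Q *ᵥ e s ω + S *ᵥ u s ω)) := by
    intro t ht ω
    rw [adjointControl, integral_exp_sub_smul_mulVec Aᵀ (hq.continuous ω) ht]
  refine ⟨fun t ht => ?_, fun ω => (h.continuous ω).congr fun t ht => e1 t ht ω⟩
  have h2 := h.adapted t ht
  rwa [funext fun ω => e1 t ht ω]

variable [m0 : MeasurableSpace Ω] {P : Measure Ω}

theorem measurable_adjointTerminal (hT : 0 ≤ T) (hle : ∀ t, ℱ t ≤ m0)
    (A Qhat Q : Matrix ι ι ℝ) (S : Matrix ι κ ℝ) {e : ℝ → Ω → ι → ℝ} {u : ℝ → Ω → κ → ℝ}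
    (he : ContAdapted ℱ T e) (hu : ContAdapted ℱ T u) :
    Measurable fun ω => adjointTerminal T A Qhat Q S (fun s => e s ω) fun s => u s ω := by
  have hTm : T ∈ Icc 0 T := ⟨hT, le_rfl⟩
  have h1 := (((he.const_mulVec Qhat).mulVec (continuous_exp_smul Aᵀ)).adapted T hTm).mono
    (hle T) le_rfl
  have h2 := (((he.const_mulVec Q).add (hu.const_mulVec S)).mulVec
    (continuous_exp_smul Aᵀ)).measurable_integral hT fun t _ => hle t
  exact h1.add h2

variable {W : Ω → ℝ} {e : ℝ → Ω → ι → ℝ} {u v : ℝ → Ω → κ → ℝ}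

theorem integrable_smul_adjointTerminal (hT : 0 < T) (hle : ∀ t, ℱ t ≤ m0)
    (A Qhat Q : Matrix ι ι ℝ) (S : Matrix ι κ ℝ) (he : ContAdapted ℱ T e)
    (hu : ContAdapted ℱ T u) (hWm : Measurable W) (hW : ∀ ω, 0 ≤ W ω) (hWint : Integrable W P)
    (hmom : Integrable (fun ω => W ω * (e T ω ⬝ᵥ e T ω
      + ∫ t in (0 : ℝ)..T, (e t ω ⬝ᵥ e t ω + u t ω ⬝ᵥ u t ω))) P) :
    Integrable (fun ω => W ω •
      adjointTerminal T A Qhat Q S (fun s => e s ω) fun s => u s ω) P := by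
  obtain ⟨C, hC, hb⟩ := exists_sq_norm_adjoint_le (κ := κ) hT A 0 Qhat Q S 0
  refine (hWint.add (hmom.const_mul C)).mono'
    (hWm.smul (measurable_adjointTerminal hT.le hle A Qhat Q S he hu)).aestronglyMeasurable
    (ae_of_all _ fun ω => ?_)
  have h1 := (hb _ _ (he.continuous ω) (hu.continuous ω)).1
  rw [norm_smul, Real.norm_of_nonneg (hW ω)]
  set θ := adjointTerminal T A Qhat Q S (fun s => e s ω) fun s => u s ω
  have h2 : ‖θ‖ ≤ 1 + ‖θ‖ ^ 2 := by nlinarith [sq_nonneg (‖θ‖ - 1), sq_nonneg ‖θ‖]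
  calc W ω * ‖θ‖ ≤ W ω * (1 + C * (e T ω ⬝ᵥ e T ω
        + ∫ t in (0 : ℝ)..T, (e t ω ⬝ᵥ e t ω + u t ω ⬝ᵥ u t ω))) :=
        mul_le_mul_of_nonneg_left (h2.trans (add_le_add le_rfl h1)) (hW ω)
    _ = _ := by simp only [Pi.add_apply]; ring

variable [IsProbabilityMeasure P]

/-- Cauchy-Schwarz with respect to the weighted measure: both parts of the gradient of the cost,
paired with the control, are integrable on `Ω × [0, T]`. -/
theorem integrable_prod_adjoint (hT : 0 < T) (hmono : Monotone ℱ) (hle : ∀ t, ℱ t ≤ m0)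
    (A : Matrix ι ι ℝ) (B : Matrix ι κ ℝ) (Qhat Q : Matrix ι ι ℝ) (S : Matrix ι κ ℝ)
    (R : Matrix κ κ ℝ) (he : ContAdapted ℱ T e) (hu : ContAdapted ℱ T u)
    (hv : ContAdapted ℱ T v) (hWm : Measurable W) (hW : ∀ ω, 0 ≤ W ω)
    (hmom : Integrable (fun ω => W ω * (e T ω ⬝ᵥ e T ω
      + ∫ t in (0 : ℝ)..T, (e t ω ⬝ᵥ e t ω + u t ω ⬝ᵥ u t ω))) P)
    (hV : Integrable (fun ω => W ω * ∫ t in (0 : ℝ)..T, ‖v t ω‖ ^ 2) P) :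
    Integrable (fun q : Ω × ℝ => (v q.2 q.1 ⬝ᵥ
        adjointControl A B Q S R (fun s => e s q.1) (fun s => u s q.1) q.2) * W q.1)
      (P.prod (volume.restrict (Icc 0 T))) ∧
    Integrable (fun q : Ω × ℝ => (NormedSpace.exp (-q.2 • A) *ᵥ (B *ᵥ v q.2 q.1)) ⬝ᵥ
        (W q.1 • adjointTerminal T A Qhat Q S (fun s => e s q.1) fun s => u s q.1))
      (P.prod (volume.restrict (Icc 0 T))) := by
  have hTm : T ∈ Icc 0 T := ⟨hT.le, le_rfl⟩
  have hle' : ∀ t ∈ Icc 0 T, ℱ t ≤ m0 := fun t _ => hle t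
  obtain ⟨C, hC, hb⟩ := exists_sq_norm_adjoint_le hT A B Qhat Q S R
  obtain ⟨CE, hCE, hE⟩ := exists_norm_exp_smul_mulVec_le A T
  obtain ⟨CB, hCB, hB⟩ := exists_norm_mulVec_le B
  set ρ : ℝ → Ω → ℝ := fun t ω => e t ω ⬝ᵥ e t ω + u t ω ⬝ᵥ u t ω with hρdef
  set N : Ω → ℝ := fun ω => e T ω ⬝ᵥ e T ω + ∫ t in (0 : ℝ)..T, ρ t ω with hN
  have hρ0 : ∀ t ω, 0 ≤ ρ t ω := fun t ω =>
    add_nonneg (dotProduct_self_nonneg _) (dotProduct_self_nonneg _)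
  have hI0 : ∀ ω, 0 ≤ ∫ t in (0 : ℝ)..T, ρ t ω := fun ω =>
    intervalIntegral.integral_nonneg hT.le fun t _ => hρ0 t ω
  have hρ : ContAdapted ℱ T ρ :=
    ⟨fun t ht => ((he.dotProduct he).adapted t ht).add ((hu.dotProduct hu).adapted t ht),
      fun ω => ((he.dotProduct he).continuous ω).add ((hu.dotProduct hu).continuous ω)⟩
  -- the three parts of the dominating function
  have d1 : Integrable (fun q : Ω × ℝ => W q.1 * N q.1)
      (P.prod (volume.restrict (Icc 0 T))) := hmom.comp_fst _
  have d2 : Integrable (fun q : Ω × ℝ => W q.1 * ρ q.2 q.1)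
      (P.prod (volume.restrict (Icc 0 T))) := by
    refine hρ.integrable_prod_mul hT.le hle' hWm hW hρ0 (hmom.mono'
      (hWm.mul (hρ.measurable_integral hT.le hle')).aestronglyMeasurable (ae_of_all _ fun ω => ?_))
    rw [Real.norm_of_nonneg (mul_nonneg (hW ω) (hI0 ω))]
    exact mul_le_mul_of_nonneg_left (le_add_of_nonneg_left (dotProduct_self_nonneg _)) (hW ω)
  have d3 : Integrable (fun q : Ω × ℝ => W q.1 * ‖v q.2 q.1‖ ^ 2)
      (P.prod (volume.restrict (Icc 0 T))) :=
    hv.sq_norm.integrable_prod_mul hT.le hle' hWm hW (fun _ _ => sq_nonneg _) hV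
  have hWm' : AEStronglyMeasurable (fun q : Ω × ℝ => W q.1)
      (P.prod (volume.restrict (Icc 0 T))) := (hWm.comp measurable_fst).aestronglyMeasurable
  constructor
  · have hc := contAdapted_adjointControl hmono A B Q S R he hu
    refine ((d3.add ((d2.add d1).const_mul C)).const_mul (Fintype.card κ : ℝ)).mono'
      (((hv.dotProduct hc).aestronglyMeasurable hT.le hle').mul hWm') ?_
    filter_upwards [ae_prod_mem_Icc] with q hq
    rw [norm_mul, Real.norm_of_nonneg (hW q.1), Real.norm_eq_abs]
    have h1 := (hb _ _ (he.continuous q.1) (hu.continuous q.1)).2 q.2 hq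
    have h2 := (abs_dotProduct_le_sq_add_sq (v q.2 q.1) (adjointControl A B Q S R (fun s => e s q.1)
      (fun s => u s q.1) q.2)).trans (mul_le_mul_of_nonneg_left
        (add_le_add (le_refl (‖v q.2 q.1‖ ^ 2)) h1) (Nat.cast_nonneg _))
    refine (mul_le_mul_of_nonneg_right h2 (hW q.1)).trans_eq ?_
    simp only [Pi.add_apply, hN, hρdef]
    ring
  · have hg : ContAdapted ℱ T fun t ω => NormedSpace.exp (-t • A) *ᵥ (B *ᵥ v t ω) :=
      (hv.const_mulVec B).mulVec ((continuous_exp_smul A).comp continuous_neg)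
    have hθ := measurable_adjointTerminal hT.le hle A Qhat Q S he hu
    have hmeas : AEStronglyMeasurable (fun q : Ω × ℝ =>
        (NormedSpace.exp (-q.2 • A) *ᵥ (B *ᵥ v q.2 q.1)) ⬝ᵥ
        (W q.1 • adjointTerminal T A Qhat Q S (fun s => e s q.1) fun s => u s q.1))
        (P.prod (volume.restrict (Icc 0 T))) :=
      (show Continuous fun z : (ι → ℝ) × (ι → ℝ) => z.1 ⬝ᵥ z.2 by
        fun_prop).comp_aestronglyMeasurable
        ((hg.aestronglyMeasurable hT.le hle').prodMk
          ((hWm.smul hθ).comp measurable_fst).aestronglyMeasurable)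
    refine (((d3.const_mul ((CE * CB) ^ 2)).add (d1.const_mul C)).const_mul
      (Fintype.card ι : ℝ)).mono' hmeas ?_
    filter_upwards [ae_prod_mem_Icc] with q hq
    rw [dotProduct_smul, smul_eq_mul, norm_mul, Real.norm_of_nonneg (hW q.1), Real.norm_eq_abs]
    have h1 := (hb _ _ (he.continuous q.1) (hu.continuous q.1)).1
    have h3 : ‖NormedSpace.exp (-q.2 • A) *ᵥ (B *ᵥ v q.2 q.1)‖ ^ 2
        ≤ (CE * CB) ^ 2 * ‖v q.2 q.1‖ ^ 2 := by
      rw [← mul_pow]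
      refine pow_le_pow_left₀ (norm_nonneg _) ?_ 2
      refine (hE (-q.2) ⟨by linarith [hq.2], by linarith [hq.1]⟩ _).trans ?_
      rw [mul_assoc]
      exact mul_le_mul_of_nonneg_left (hB _) hCE
    have h2 := (abs_dotProduct_le_sq_add_sq (NormedSpace.exp (-q.2 • A) *ᵥ (B *ᵥ v q.2 q.1))
      (adjointTerminal T A Qhat Q S (fun s => e s q.1) fun s => u s q.1)).trans
        (mul_le_mul_of_nonneg_left (add_le_add h3 h1) (Nat.cast_nonneg _))
    refine (mul_le_mul_of_nonneg_left h2 (hW q.1)).trans_eq ?_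
    simp only [Pi.add_apply, hN, hρdef]
    ring

/-- The expectation of the weighted derivative of the cost is the expectation of an integral against
the control, in which the weight and the weighted adjoint vector are replaced by their conditional
expectations. -/
theorem integral_weighted_quadCostDeriv (hT : 0 < T) (hmono : Monotone ℱ) (hle : ∀ t, ℱ t ≤ m0)
    (A : Matrix ι ι ℝ) (B : Matrix ι κ ℝ) (Qhat Q : Matrix ι ι ℝ) (S : Matrix ι κ ℝ)
    (R : Matrix κ κ ℝ) (he : ContAdapted ℱ T e) (hu : ContAdapted ℱ T u)
    (hv : ContAdapted ℱ T v) {z : ℝ → Ω → ι → ℝ} (hz : ∀ t ω, z t ω = NormedSpace.exp (t • A) *ᵥ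
      ∫ s in (0 : ℝ)..t, NormedSpace.exp (-s • A) *ᵥ (B *ᵥ v s ω))
    (hWm : Measurable W) (hW : ∀ ω, 0 ≤ W ω) (hWint : Integrable W P)
    (hmom : Integrable (fun ω => W ω * (e T ω ⬝ᵥ e T ω
      + ∫ t in (0 : ℝ)..T, (e t ω ⬝ᵥ e t ω + u t ω ⬝ᵥ u t ω))) P)
    (hV : Integrable (fun ω => W ω * ∫ t in (0 : ℝ)..T, ‖v t ω‖ ^ 2) P)
    {M₁ : ℝ → Ω → ℝ} {M₂ : ℝ → Ω → ι → ℝ} (hM₁ : IsCondExpProcess P ℱ T W M₁)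
    (hM₂ : IsCondExpProcess P ℱ T (fun ω => W ω •
      adjointTerminal T A Qhat Q S (fun s => e s ω) fun s => u s ω) M₂) :
    Integrable (fun q : Ω × ℝ => v q.2 q.1 ⬝ᵥ
        (M₁ q.2 q.1 • adjointControl A B Q S R (fun s => e s q.1) (fun s => u s q.1) q.2
          + Bᵀ *ᵥ (NormedSpace.exp (-q.2 • Aᵀ) *ᵥ M₂ q.2 q.1)))
      (P.prod (volume.restrict (Icc 0 T))) ∧
    ∫ ω, W ω * quadCostDeriv T Qhat Q S R (fun t => e t ω) (fun t => u t ω) (fun t => z t ω)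
        (fun t => v t ω) ∂P
      = ∫ ω, (∫ t in (0 : ℝ)..T, v t ω ⬝ᵥ
        (M₁ t ω • adjointControl A B Q S R (fun s => e s ω) (fun s => u s ω) t
          + Bᵀ *ᵥ (NormedSpace.exp (-t • Aᵀ) *ᵥ M₂ t ω))) ∂P := by
  have hle' : ∀ t ∈ Icc 0 T, ℱ t ≤ m0 := fun t _ => hle t
  obtain ⟨i1, i2⟩ := integrable_prod_adjoint hT hmono hle A B Qhat Q S R he hu hv hWm hW hmom hV
  have hα := hv.dotProduct (contAdapted_adjointControl hmono A B Q S R he hu)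
  have hg : ContAdapted ℱ T fun t ω => NormedSpace.exp (-t • A) *ᵥ (B *ᵥ v t ω) :=
    (hv.const_mulVec B).mulVec ((continuous_exp_smul A).comp continuous_neg)
  obtain ⟨j1, k1⟩ := integrable_prod_condExpProcess (ContinuousLinearMap.mul ℝ ℝ) hle' hWint hM₁
    (fun t ht => (hα.adapted t ht).stronglyMeasurable) (hα.aestronglyMeasurable hT.le hle') i1
  let L : (ι → ℝ) →L[ℝ] (ι → ℝ) →L[ℝ] ℝ :=
    LinearMap.toContinuousBilinearMap (dotProductBilin ℝ ℝ)
  obtain ⟨j2, k2⟩ := integrable_prod_condExpProcess L hle'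
    (integrable_smul_adjointTerminal hT hle A Qhat Q S he hu hWm hW hWint hmom) hM₂
    (fun t ht => (hg.adapted t ht).stronglyMeasurable) (hg.aestronglyMeasurable hT.le hle') i2
  have hsplit : ∀ t ω, v t ω ⬝ᵥ
      (M₁ t ω • adjointControl A B Q S R (fun s => e s ω) (fun s => u s ω) t
        + Bᵀ *ᵥ (NormedSpace.exp (-t • Aᵀ) *ᵥ M₂ t ω))
      = (v t ω ⬝ᵥ adjointControl A B Q S R (fun s => e s ω) (fun s => u s ω) t) * M₁ t ω
        + (NormedSpace.exp (-t • A) *ᵥ (B *ᵥ v t ω)) ⬝ᵥ M₂ t ω := by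
    intro t ω
    rw [dotProduct_add, dotProduct_smul, smul_eq_mul, mul_comm, ← dotProduct_mulVec_comm,
      ← dotProduct_exp_smul_mulVec, dotProduct_comm (M₂ t ω)]
  have hmain := j1.add j2
  refine ⟨hmain.congr (ae_of_all _ fun q => (hsplit q.2 q.1).symm), ?_⟩
  have hprod {φ : Ω × ℝ → ℝ} (h : Integrable φ (P.prod (volume.restrict (Icc 0 T)))) :
      ∫ ω, (∫ t in (0 : ℝ)..T, φ (ω, t)) ∂P
        = ∫ q, φ q ∂(P.prod (volume.restrict (Icc 0 T))) := by
    rw [integral_prod _ h]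
    simp only [intervalIntegral.integral_of_le hT.le, integral_Icc_eq_integral_Ioc]
  simp only [hsplit]
  refine Eq.trans ?_ (hprod hmain).symm
  refine Eq.trans ?_ ((integral_add i1 i2).trans
    ((congrArg₂ (· + ·) k1.symm k2.symm).trans (integral_add j1 j2).symm))
  refine Eq.trans ?_ (hprod (i1.add i2))
  refine integral_congr_ae (ae_of_all _ fun ω => ?_)
  beta_reduce
  rw [quadCostDeriv_eq_integral hT.le A B Qhat Q S R (he.continuous ω) (hu.continuous ω)
    (hv.continuous ω) fun t _ => hz t ω, ← intervalIntegral.integral_const_mul]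
  refine intervalIntegral.integral_congr fun t _ => ?_
  simp only [dotProduct_smul, smul_eq_mul]
  ring

end WeightedDuality

end RiskMFG

/-! ### The Gâteaux derivative of the cost -/

theorem mainTheorem5 {K n m r : ℕ} (D : RiskMFG.Model K n m r)
    {Ω : Type*} [MeasurableSpace Ω] (P : Measure Ω) [IsProbabilityMeasure P]
    (p : RiskMFG.Population D P) (i : ℕ)
    (hconv : D.ConvexityCondition (p.type i))
    (v : ℝ → Ω → Fin m → ℝ) (hv : p.IsAdmissible i v)
    (hfin : ∃ ε₀ > 0, ∀ ε : ℝ, |ε| < ε₀ → p.HasFiniteCost i (p.u i + ε • v))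
    (hmom : Integrable (fun ω => Real.exp (D.G (p.type i) (p.x i) p.xbar (p.u i) ω) *
      (D.err (p.type i) (p.x i D.T ω) (p.xbar D.T ω) ⬝ᵥ
          D.err (p.type i) (p.x i D.T ω) (p.xbar D.T ω)
        + ∫ t in (0 : ℝ)..D.T,
            (D.err (p.type i) (p.x i t ω) (p.xbar t ω) ⬝ᵥ
                D.err (p.type i) (p.x i t ω) (p.xbar t ω)
              + p.u i t ω ⬝ᵥ p.u i t ω))) P) :
    Integrable (D.weightedAdjoint (p.type i) (p.x i) p.xbar (p.u i)) P ∧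
    (∃ M₁ : ℝ → Ω → ℝ, RiskMFG.IsCondExpProcess P (p.filtration i) D.T
      (fun ω => Real.exp (D.G (p.type i) (p.x i) p.xbar (p.u i) ω)) M₁) ∧
    (∃ M₂ : ℝ → Ω → Fin n → ℝ, RiskMFG.IsCondExpProcess P (p.filtration i) D.T
      (D.weightedAdjoint (p.type i) (p.x i) p.xbar (p.u i)) M₂) ∧
    ∀ (M₁ : ℝ → Ω → ℝ) (M₂ : ℝ → Ω → Fin n → ℝ),
      RiskMFG.IsCondExpProcess P (p.filtration i) D.T
        (fun ω => Real.exp (D.G (p.type i) (p.x i) p.xbar (p.u i) ω)) M₁ →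
      RiskMFG.IsCondExpProcess P (p.filtration i) D.T
        (D.weightedAdjoint (p.type i) (p.x i) p.xbar (p.u i)) M₂ →
      Integrable (fun q : Ω × ℝ =>
          v q.2 q.1 ⬝ᵥ D.h (p.type i) (p.x i) p.xbar (p.u i) M₁ M₂ q.2 q.1)
        (P.prod (volume.restrict (Icc 0 D.T))) ∧
      RiskMFG.HasGateauxDerivative (p.J i) (p.u i) v
        ((∫ ω, (∫ t in (0 : ℝ)..D.T,
            v t ω ⬝ᵥ D.h (p.type i) (p.x i) p.xbar (p.u i) M₁ M₂ t ω) ∂P) /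
          ∫ ω, Real.exp (D.G (p.type i) (p.x i) p.xbar (p.u i) ω) ∂P) := by
  have hT := D.T_pos
  set k := p.type i with hk
  have hmono := p.filtration_mono i
  have hle := p.filtration_le i
  have hle' : ∀ t ∈ Icc 0 D.T, p.filtration i t ≤ ‹MeasurableSpace Ω› := fun t _ => hle t
  have hleft : ∀ t ∈ Icc 0 D.T, ∀ d : ℕ → ℝ, (∀ n, 0 ≤ d n) → (∀ n, d n ≤ t) →
      Tendsto d atTop (𝓝 t) → p.filtration i t ≤ ⨆ n, p.filtration i (d n) :=
    fun t _ d hd0 _ hd => p.filtration_le_iSup i hd0 hd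
  have cv : RiskMFG.ContAdapted (p.filtration i) D.T v := ⟨hv.adapted, hv.continuous⟩
  have cu : RiskMFG.ContAdapted (p.filtration i) D.T (p.u i) :=
    ⟨(p.u_admissible i).adapted, (p.u_admissible i).continuous⟩
  have cxb : RiskMFG.ContAdapted (p.filtration i) D.T p.xbar :=
    RiskMFG.ContAdapted.mono (ℱ := p.commonFiltration)
      ⟨p.xbar_meanField.adapted, p.xbar_meanField.continuous⟩
      fun t _ => p.commonFiltration_le_filtration i t
  have ce : RiskMFG.ContAdapted (p.filtration i) D.T
      fun t ω => D.err k (p.x i t ω) (p.xbar t ω) :=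
    RiskMFG.Model.contAdapted_err ⟨(p.x_state i).adapted, (p.x_state i).continuous⟩ cxb
  have cz : RiskMFG.ContAdapted (p.filtration i) D.T (D.response k v) :=
    RiskMFG.Model.contAdapted_response hmono cv
  set W : Ω → ℝ := fun ω => Real.exp (D.G k (p.x i) p.xbar (p.u i) ω) with hWdef
  have hW : ∀ ω, 0 ≤ W ω := fun ω => (Real.exp_pos _).le
  have hWm : Measurable W := Real.measurable_exp.comp
    ((ce.measurable_quadCost hT.le hle' (D.Qhat k) (D.Q k) (D.S k) (D.R k) cu).const_mul _)
  -- the coefficients of the exponent, a quadratic polynomial in the step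
  set a : Ω → ℝ := fun ω => (1 / D.γ k) * RiskMFG.quadCostDeriv D.T (D.Qhat k) (D.Q k) (D.S k)
    (D.R k) (fun t => D.err k (p.x i t ω) (p.xbar t ω)) (fun t => p.u i t ω)
    (fun t => D.response k v t ω) (fun t => v t ω) with ha
  set b : Ω → ℝ := fun ω => (1 / D.γ k) * RiskMFG.quadCost D.T (D.Qhat k) (D.Q k) (D.S k)
    (D.R k) (fun t => D.response k v t ω) (fun t => v t ω) with hb
  have hγ := D.γ_pos k
  obtain ⟨c, hc, hcoer⟩ := RiskMFG.exists_pos_mul_integral_sq_norm_le_quadCost hT (D.A k) (D.B k)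
    (D.R_symm k) hconv.1 hconv.2.1 hconv.2.2
  -- the response solves its equation for every `ω`, so no null set enters here
  have hVb : ∀ ω, c * (∫ t in (0 : ℝ)..D.T, ‖v t ω‖ ^ 2) ≤ D.γ k * b ω := fun ω => by
    have h1 := hcoer (fun t => D.response k v t ω) (fun t => v t ω) (cz.continuous ω)
      (cv.continuous ω) fun t ht => RiskMFG.exp_mulVec_integral_eq (D.A k)
        (RiskMFG.continuousOn_mulVec continuousOn_const (cv.continuous ω)) (fun _ => rfl) ht
    refine h1.trans_eq ?_
    simp only [hb]
    field_simp
  have hV0 : ∀ ω, 0 ≤ ∫ t in (0 : ℝ)..D.T, ‖v t ω‖ ^ 2 := fun ω =>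
    intervalIntegral.integral_nonneg hT.le fun t _ => sq_nonneg _
  have hb0 : ∀ ω, 0 ≤ b ω := fun ω =>
    nonneg_of_mul_nonneg_right ((mul_nonneg hc.le (hV0 ω)).trans (hVb ω)) hγ
  obtain ⟨ε₀, hε₀, hfin⟩ := hfin
  have hδ : 0 < ε₀ / 2 := by positivity
  have hint : ∀ ε, |ε| ≤ ε₀ / 2 → Integrable (fun ω =>
      Real.exp (D.G k (p.x i) p.xbar (p.u i) ω + ε * a ω + ε ^ 2 * b ω)) P := by
    intro ε hε
    obtain ⟨y, yb, hdev, hi⟩ := hfin ε (by linarith)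
    refine hi.congr ?_
    filter_upwards [hdev.G_ae_eq hv] with ω hω
    rw [hω]
  have hJ : ∀ ε, |ε| < ε₀ → p.J i (p.u i + ε • v) = D.γ k * Real.log
      (∫ ω, Real.exp (D.G k (p.x i) p.xbar (p.u i) ω + ε * a ω + ε ^ 2 * b ω) ∂P) := by
    intro ε hε
    obtain ⟨y, yb, hdev, -⟩ := hfin ε hε
    exact RiskMFG.Population.J_eq_of_isDeviation ⟨y, yb, hdev⟩ fun _ _ h => h.G_ae_eq hv
  have hWint : Integrable W P := by simpa using hint 0 (by simpa using hδ.le)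
  have hbm : Measurable b :=
    (cz.measurable_quadCost hT.le hle' (D.Qhat k) (D.Q k) (D.S k) (D.R k) cv).const_mul _
  have hbint := RiskMFG.integrable_exp_mul_quadratic (ae_of_all _ hb0) hδ
    (hWm.mul hbm).aestronglyMeasurable hint
  -- the direction is square integrable under the weighted measure
  have hV : Integrable (fun ω => W ω * ∫ t in (0 : ℝ)..D.T, ‖v t ω‖ ^ 2) P := by
    refine (hbint.const_mul (D.γ k / c)).mono'
      (hWm.mul (cv.sq_norm.measurable_integral hT.le hle')).aestronglyMeasurable
      (ae_of_all _ fun ω => ?_)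
    rw [Real.norm_of_nonneg (mul_nonneg (hW ω) (hV0 ω))]
    have h1 : ∫ t in (0 : ℝ)..D.T, ‖v t ω‖ ^ 2 ≤ D.γ k / c * b ω := by
      rw [div_mul_eq_mul_div, le_div_iff₀ hc, mul_comm]
      exact hVb ω
    calc W ω * ∫ t in (0 : ℝ)..D.T, ‖v t ω‖ ^ 2 ≤ W ω * (D.γ k / c * b ω) :=
          mul_le_mul_of_nonneg_left h1 (hW ω)
      _ = _ := by ring
  rw [RiskMFG.Model.weightedAdjoint_eq]
  simp only [RiskMFG.Model.h_eq]
  have hY :=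
    RiskMFG.integrable_smul_adjointTerminal hT hle (D.A k) (D.Qhat k) (D.Q k) (D.S k) ce cu hWm hW
      hWint hmom
  refine ⟨hY, RiskMFG.exists_isCondExpProcess_real hmono hle hleft _,
    RiskMFG.exists_isCondExpProcess_pi hmono hle hleft hY, fun M₁ M₂ hM₁ hM₂ => ?_⟩
  obtain ⟨hi, heq⟩ := RiskMFG.integral_weighted_quadCostDeriv hT hmono hle (D.A k) (D.B k)
    (D.Qhat k) (D.Q k) (D.S k) (D.R k) ce cu cv (z := D.response k v) (fun _ _ => rfl) hWm hW hWint
    hmom hV hM₁ hM₂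
  refine ⟨hi, ?_⟩
  have hpos : 0 < ∫ ω, W ω ∂P := integral_exp_pos hWint
  have hder := RiskMFG.hasDerivAt_integral_exp_quadratic (ae_of_all P hb0) hδ hint
  have hder2 := (hder.log (by simpa using hpos.ne')).const_mul (D.γ k)
  have hlim := hasDerivAt_iff_tendsto_slope_zero.1 hder2
  have hval : D.γ k * ((∫ ω, W ω * a ω ∂P) / ∫ ω, W ω ∂P)
      = (∫ ω, (∫ t in (0 : ℝ)..D.T,
          v t ω ⬝ᵥ (M₁ t ω • RiskMFG.adjointControl (D.A k) (D.B k) (D.Q k) (D.S k) (D.R k)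
              (fun t => D.err k (p.x i t ω) (p.xbar t ω)) (fun t => p.u i t ω) t
            + (D.B k)ᵀ *ᵥ (NormedSpace.exp (-t • (D.A k)ᵀ) *ᵥ M₂ t ω))) ∂P) /
        ∫ ω, W ω ∂P := by
    rw [← mul_div_assoc, ← integral_const_mul]
    congr 1
    refine Eq.trans (integral_congr_ae (ae_of_all _ fun ω => ?_)) heq
    simp only [ha]
    field_simp
  rw [RiskMFG.HasGateauxDerivative, ← hval]
  have hlim' := hlim
  simp only [zero_mul, add_zero, ne_eq, OfNat.ofNat_ne_zero, not_false_eq_true, zero_pow,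
    zero_add] at hlim'
  refine hlim'.congr' ?_
  have hev : ∀ᶠ ε : ℝ in 𝓝[≠] 0, |ε| < ε₀ := by
    refine eventually_nhdsWithin_of_eventually_nhds ?_
    filter_upwards [Metric.ball_mem_nhds (0 : ℝ) hε₀] with ε hε
    simpa using hε
  have hJ0 := hJ 0 (by simpa using hε₀)
  simp only [zero_smul, zero_mul, add_zero, ne_eq, OfNat.ofNat_ne_zero, not_false_eq_true,
    zero_pow] at hJ0
  filter_upwards [hev] with ε hε
  rw [hJ ε hε, hJ0, smul_eq_mul, inv_mul_eq_div]
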